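/- Let $M$ be a smooth $n$-manifold and let $g$ be a semi-Riemannian metric on $M$ of constant signature $(p,q)$, $p+q=n$, and of regularity $C^k$ with $k\in\mathbb N$, $k\ge 2$. Let $\nabla$ be the Levi-Civita connection of $g$, and let $\mathrm{Riem}_g(X,Y)Z=\nabla_X\nabla_YZ-\nabla_Y\nabla_XZ-\nabla_{[X,Y]}Z$ be the distributional Riemann curvature tensor: in every smooth chart its components are the distributions $\partial_c\Gamma^a_{db}-\partial_d\Gamma^a_{cb}+\Gamma^a_{cs}\Gamma^s_{db}-\Gamma^a_{ds}\Gamma^s_{cb}$, acting on compactly supported $C^1$ test densities. For $r\ge 1$ call $(M,g)$ *$C^r$ frame-flat* if every point of $M$ has an open neighbourhood $U$ with a $g$-orthonormal frame $E_1,\dots,E_n$ of class $C^r$ on $U$ (that is, $g(E_i,E_j)=0$ for $i\neq j$ and $g(E_i,E_i)=\pm1$) consisting of parallel vector fields. Call *flat $C^r$ coordinates* a $C^r$ diffeomorphism $\phi$ from an open subset of $M$ onto an open subset of $\mathbb R^n$ with $\phi^*g_{p,q}=g$, where $g_{p,q}$ is the semi-Euclidean metric of signature $(p,q)$, and call $(M,g)$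 *$C^r$ coordinate-flat* if every point of $M$ lies in the domain of flat $C^r$ coordinates. Then the following hold. 1. $\mathrm{Riem}_g$ is a $C^{k-2}$ tensor field: there is a $(1,3)$-tensor field $R$ on $M$ of class $C^{k-2}$ such that the distribution $\mathrm{Riem}_g$ is given by integration against $R$ in every smooth chart. 2. The following are equivalent: (a) $\mathrm{Riem}_g=0$ as a distributional tensor of order one; (b) $R=0$ at every point of $M$; (c) $(M,g)$ is $C^1$ frame-flat; (d) $(M,g)$ is $C^k$ frame-flat; (e) $(M,g)$ is $C^2$ coordinate-flat; (f) $(M,g)$ is $C^{k+1}$ coordinate-flat. 3. Every parallel orthonormal frame of class $C^1$ on an open subset of $M$ is of class $C^k$, and all flat $C^2$ coordinates on open subsets of $M$ are flat $C^{k+1}$ coordinates. -/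

import Mathlib

open scoped Manifold ContDiff
open MeasureTheory

noncomputable section

/-- The sign `ε_i` of the `i`-th standard coordinate of the semi-Euclidean space `ℝ^{p,q}`:
the first `p` coordinates are positive, the remaining ones are negative. -/
def semiEuclideanSign (p : ℕ) {n : ℕ} (i : Fin n) : ℝ := if (i : ℕ) < p then 1 else -1

section Manifold

variable {n : ℕ} {M : Type*} [TopologicalSpace M] [ChartedSpace (EuclideanSpace ℝ (Fin n)) M]
  [IsManifold (𝓡 n) ∞ M]

/-- A semi-Riemannian metric of regularity `C^m` and of constant signature `(p, n - p)` (`p` positive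
and `n - p` negative directions) on the smooth `n`-manifold `M`. -/
structure SemiRiemannianMetric (m : ℕ∞ω) (p n : ℕ) (M : Type*) [TopologicalSpace M]
    [ChartedSpace (EuclideanSpace ℝ (Fin n)) M] [IsManifold (𝓡 n) ∞ M] where
  /-- the bilinear form on each tangent space -/
  form (x : M) : TangentSpace (𝓡 n) x →L[ℝ] TangentSpace (𝓡 n) x →L[ℝ] ℝ
  symm (x : M) (v w : TangentSpace (𝓡 n) x) : form x v w = form x w v
  signature (x : M) : ∃ b : Module.Basis (Fin n) ℝ (TangentSpace (𝓡 n) x),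
    ∀ i j, form x (b i) (b j) = if i = j then semiEuclideanSign p i else 0
  contMDiff : ContMDiff (𝓡 n)
    ((𝓡 n).prod 𝓘(ℝ, EuclideanSpace ℝ (Fin n) →L[ℝ] EuclideanSpace ℝ (Fin n) →L[ℝ] ℝ)) m
    (fun x ↦ Bundle.TotalSpace.mk'
      (EuclideanSpace ℝ (Fin n) →L[ℝ] EuclideanSpace ℝ (Fin n) →L[ℝ] ℝ)
      (E := fun x : M ↦ TangentSpace (𝓡 n) x →L[ℝ] TangentSpace (𝓡 n) x →L[ℝ] ℝ) x (form x))

/-- The set of all smooth charts of `M`. -/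
abbrev smoothCharts (n : ℕ) (M : Type*) [TopologicalSpace M]
    [ChartedSpace (EuclideanSpace ℝ (Fin n)) M] :
    Set (OpenPartialHomeomorph M (EuclideanSpace ℝ (Fin n))) :=
  IsManifold.maximalAtlas (𝓡 n) ∞ M

/-- The partial derivative `∂_j f` of a real function on `ℝⁿ`. -/
def partialD (j : Fin n) (f : EuclideanSpace ℝ (Fin n) → ℝ) (y : EuclideanSpace ℝ (Fin n)) : ℝ :=
  fderiv ℝ f y (EuclideanSpace.single j 1)

/-- The coordinate vector `∂_i` of the chart `e`, at the point with coordinates `y`. -/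
def coordVec (e : OpenPartialHomeomorph M (EuclideanSpace ℝ (Fin n))) (i : Fin n)
    (y : EuclideanSpace ℝ (Fin n)) : TangentSpace (𝓡 n) (e.symm y) :=
  mfderiv (𝓡 n) (𝓡 n) e.symm y (EuclideanSpace.single i (1 : ℝ) : EuclideanSpace ℝ (Fin n))

/-- The `i`-th component, in the chart `e`, of a tangent vector `v` at `x`. -/
def vecComp (e : OpenPartialHomeomorph M (EuclideanSpace ℝ (Fin n))) (i : Fin n) {x : M}
    (v : TangentSpace (𝓡 n) x) : ℝ :=
  let w : EuclideanSpace ℝ (Fin n) := mfderiv (𝓡 n) (𝓡 n) e x v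
  w i

namespace SemiRiemannianMetric

variable {m : ℕ∞ω} {p : ℕ}

/-- The matrix `(g_{ij})` of the metric in the chart `e`. -/
def coordMatrix (g : SemiRiemannianMetric m p n M)
    (e : OpenPartialHomeomorph M (EuclideanSpace ℝ (Fin n))) (y : EuclideanSpace ℝ (Fin n)) :
    Matrix (Fin n) (Fin n) ℝ :=
  Matrix.of fun i j ↦ g.form (e.symm y) (coordVec e i y) (coordVec e j y)

/-- The Christoffel symbols of the Levi-Civita connection in the chart `e`:
`Γ^a_{bc} = ½ g^{al} (∂_c g_{lb} + ∂_b g_{cl} - ∂_l g_{bc})`. -/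
def christoffel (g : SemiRiemannianMetric m p n M)
    (e : OpenPartialHomeomorph M (EuclideanSpace ℝ (Fin n))) (a b c : Fin n)
    (y : EuclideanSpace ℝ (Fin n)) : ℝ :=
  (1 / 2) * ∑ l, (g.coordMatrix e y)⁻¹ a l *
    (partialD c (fun z ↦ g.coordMatrix e z l b) y + partialD b (fun z ↦ g.coordMatrix e z c l) y
      - partialD l (fun z ↦ g.coordMatrix e z b c) y)

/-- The distributional Riemann curvature tensor
`Riem(X, Y) Z = ∇_X ∇_Y Z - ∇_Y ∇_X Z - ∇_{[X, Y]} Z`, through its components in the chart `e`.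
The component `Riem^a_{bcd}`, i.e. the `∂_a`-component of `Riem(∂_c, ∂_d) ∂_b`, is the distribution
`∂_c Γ^a_{db} - ∂_d Γ^a_{cb} + ∑_s (Γ^a_{cs} Γ^s_{db} - Γ^a_{ds} Γ^s_{cb})`
on the image of the chart; this is its value on the test density `φ dx¹ ⋯ dxⁿ`, with the derivatives
of the Christoffel symbols moved to `φ`. -/
def distRiemann (g : SemiRiemannianMetric m p n M)
    (e : OpenPartialHomeomorph M (EuclideanSpace ℝ (Fin n))) (a b c d : Fin n)
    (φ : EuclideanSpace ℝ (Fin n) → ℝ) : ℝ :=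
  ∫ y, (-(g.christoffel e a d b y * partialD c φ y) + g.christoffel e a c b y * partialD d φ y
    + (∑ s, (g.christoffel e a c s y * g.christoffel e s d b y
        - g.christoffel e a d s y * g.christoffel e s c b y)) * φ y)

end SemiRiemannianMetric

/-- Test functions of order one for a chart `e`: `C^1` functions with compact support contained in
the image of `e`. -/
def IsTestFunction (e : OpenPartialHomeomorph M (EuclideanSpace ℝ (Fin n)))
    (φ : EuclideanSpace ℝ (Fin n) → ℝ) : Prop :=
  ContDiff ℝ 1 φ ∧ HasCompactSupport φ ∧ tsupport φ ⊆ e.target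

/-- A (not necessarily continuous) `(1,3)`-tensor field, `R x X Y Z` standing for `R(X, Y) Z`. -/
abbrev TensorField13 (n : ℕ) (M : Type*) [TopologicalSpace M]
    [ChartedSpace (EuclideanSpace ℝ (Fin n)) M] : Type _ :=
  (x : M) → TangentSpace (𝓡 n) x →ₗ[ℝ] TangentSpace (𝓡 n) x →ₗ[ℝ] TangentSpace (𝓡 n) x →ₗ[ℝ]
    TangentSpace (𝓡 n) x

/-- The component `R^a_{bcd}` in the chart `e`: the `∂_a`-component of `R(∂_c, ∂_d) ∂_b`. -/
def TensorField13.comp (R : TensorField13 n M)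
    (e : OpenPartialHomeomorph M (EuclideanSpace ℝ (Fin n))) (a b c d : Fin n)
    (y : EuclideanSpace ℝ (Fin n)) : ℝ :=
  vecComp e a (R (e.symm y) (coordVec e c y) (coordVec e d y) (coordVec e b y))

/-- The tensor field is of regularity `C^r`: its components in all smooth charts are `C^r`. -/
def TensorField13.IsOfClass (r : ℕ∞ω) (R : TensorField13 n M) : Prop :=
  ∀ e ∈ smoothCharts n M, ∀ a b c d, ContDiffOn ℝ r (R.comp e a b c d) e.target

namespace SemiRiemannianMetric

variable {m : ℕ∞ω} {p : ℕ}

/-- The distributional Riemann tensor of `g` is given by the tensor field `R`. -/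
def RiemannEq (g : SemiRiemannianMetric m p n M) (R : TensorField13 n M) : Prop :=
  ∀ e ∈ smoothCharts n M, ∀ a b c d, ∀ φ, IsTestFunction e φ →
    g.distRiemann e a b c d φ = ∫ y, R.comp e a b c d y * φ y

/-- `Riem_g = 0` as a distributional tensor of order one. -/
def IsCurvatureFlat (g : SemiRiemannianMetric m p n M) : Prop :=
  ∀ e ∈ smoothCharts n M, ∀ a b c d, ∀ φ, IsTestFunction e φ → g.distRiemann e a b c d φ = 0

/-- The vector field `V` is parallel on the open set `U`: `∂_j V^i + Γ^i_{jk} V^k = 0` there, in all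
smooth charts. (Only used for `V` of class `C^1` on `U`.) -/
def IsParallelOn (g : SemiRiemannianMetric m p n M) (V : (x : M) → TangentSpace (𝓡 n) x)
    (U : Set M) : Prop :=
  ∀ e ∈ smoothCharts n M, ∀ y ∈ e.target ∩ e.symm ⁻¹' U, ∀ i j,
    partialD j (fun z ↦ vecComp e i (V (e.symm z))) y
      + ∑ k, g.christoffel e i j k y * vecComp e k (V (e.symm y)) = 0

/-- `E_1, …, E_n` is an orthonormal frame of regularity `C^r` on the open set `U` that consists of
parallel vector fields. -/
structure IsParallelOrthonormalFrame (g : SemiRiemannianMetric m p n M) (r : ℕ∞ω)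
    (E : Fin n → (x : M) → TangentSpace (𝓡 n) x) (U : Set M) : Prop where
  isOpen : IsOpen U
  contMDiffOn (i : Fin n) : ContMDiffOn (𝓡 n) (𝓡 n).tangent r
    (fun x ↦ (⟨x, E i x⟩ : TangentBundle (𝓡 n) M)) U
  orthogonal (x : M) (hx : x ∈ U) (i j : Fin n) (hij : i ≠ j) : g.form x (E i x) (E j x) = 0
  unit (x : M) (hx : x ∈ U) (i : Fin n) :
    g.form x (E i x) (E i x) = 1 ∨ g.form x (E i x) (E i x) = -1
  parallel (i : Fin n) : g.IsParallelOn (E i) U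

/-- `C^r` frame-flatness: parallel orthonormal `C^r` frames exist near every point. -/
def IsFrameFlat (g : SemiRiemannianMetric m p n M) (r : ℕ∞ω) : Prop :=
  ∀ x : M, ∃ U : Set M, x ∈ U ∧ ∃ E : Fin n → (x : M) → TangentSpace (𝓡 n) x,
    g.IsParallelOrthonormalFrame r E U

/-- `φ` is a `C^r` diffeomorphism from an open subset of `M` onto an open subset of `ℝⁿ` that pulls
the semi-Euclidean metric of the signature of `g` back to `g`. -/
structure IsFlatCoordinates (g : SemiRiemannianMetric m p n M) (r : ℕ∞ω)
    (φ : OpenPartialHomeomorph M (EuclideanSpace ℝ (Fin n))) : Prop where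
  contMDiffOn : ContMDiffOn (𝓡 n) (𝓡 n) r φ φ.source
  contMDiffOn_symm : ContMDiffOn (𝓡 n) (𝓡 n) r φ.symm φ.target
  isometry (x : M) (hx : x ∈ φ.source) (v w : TangentSpace (𝓡 n) x) :
    ∑ i, semiEuclideanSign p i * vecComp φ i v * vecComp φ i w = g.form x v w

/-- `C^r` coordinate-flatness: flat `C^r` coordinates exist near every point. -/
def IsCoordinateFlat (g : SemiRiemannianMetric m p n M) (r : ℕ∞ω) : Prop :=
  ∀ x : M, ∃ φ : OpenPartialHomeomorph M (EuclideanSpace ℝ (Fin n)),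
    x ∈ φ.source ∧ g.IsFlatCoordinates r φ

end SemiRiemannianMetric

end Manifold

end

/-!
The theorem is local, and every notion in it is expressed in smooth charts. There the metric is a
map `G` into the bilinear forms on `ℝⁿ`, and its Christoffel symbols are a map `Γ` into the
bilinear maps on `ℝⁿ`, of class `C^{k-1}`, characterised by the Koszul formula
(`SemiRiemannianMetric.satisfiesKoszul`).

*The curvature tensor.* The Koszul formula yields the transformation law
`Γ'(Dψ u, Dψ v) + D²ψ(u, v) = Dψ Γ(u, v)` under a `C²` isometry `ψ` (`SatisfiesKoszul.transform`).
For a transition map between smooth charts, one more differentiation shows that the curvature of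
`Γ` transforms as a tensor (`curvature_transform`), so that the curvatures in the preferred charts
define a tensor field `R`, of class `C^{k-2}`. Integrating the derivatives of `Γ` by parts
shows that the distributional curvature is integration against `R` (`riemannEq_riemannTensor`); as
`R` is continuous, one vanishes if and only if the other does (`isCurvatureFlat_iff`).

*From `R = 0` to coordinates.* The derivative `A` of flat coordinates has to solve
`D_u A = A ∘ Γ(u, ·)`. This linear total differential equation is integrable exactly because the
curvature vanishes, and it is solved along rays from a point; Grönwall's inequality gives the
differentiability of the solution in all directions
(`exists_hasFDerivAt_of_integrable`). Since `Γ` is symmetric, `A` is closed, and the Poincaré lemma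
gives `ψ` with `Dψ = A`. Both `G` and the pull-back of the semi-Euclidean form by `A` solve the same
linear equation, so that `ψ` is an isometry if it is one at the centre (`exists_local_isometry`).
The inverse function theorem makes `ψ` a chart.

*Regularity.* For flat `C²` coordinates `ψ` in a smooth chart, the transformation law with `Γ' = 0`
reads `D²ψ = Dψ ∘ Γ`, and a bootstrap (`contDiffOn_of_fderiv_eq_flip`) gives `ψ ∈ C^{k+1}`
(`IsFlatCoordinates.improve`). The components of a parallel field satisfy `DW = -Γ(·, W)`, whence
they are `C^k` by the same bootstrap (`IsParallelOrthonormalFrame.improve`).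

*Frames.* The coordinate fields of flat coordinates are a parallel orthonormal frame. Conversely, a
parallel field `W` satisfies `R(u, v) W = 0` by the symmetry of its second derivative, so that `R`
vanishes where there is a parallel orthonormal frame.
-/

noncomputable section

set_option maxSynthPendingDepth 3

open Set Metric Filter Topology

/-! ### Linear total differential equations -/

section LinearPDE

variable {V : Type*} [NormedAddCommGroup V] [NormedSpace ℝ V]
  {F : Type*} [NormedAddCommGroup F] [NormedSpace ℝ F]

/-- The linear total differential equation `Df(x) u = L(x) u (f x)` is *integrable* at `x`: the
expression `D_u L v + L_v L_u`, which is the second derivative `D²f(u, v)` of a solution, is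
symmetric in `u` and `v`. -/
def IsIntegrableAt (L : V → V →L[ℝ] F →L[ℝ] F) (x : V) : Prop :=
  ∀ u v w, fderiv ℝ L x u v w + L x v (L x u w) = fderiv ℝ L x v u w + L x u (L x v w)

variable (V F) in
/-- Flipping the arguments of a bilinear map, as a continuous linear map. -/
def flipCLM (H : Type*) [NormedAddCommGroup H] [NormedSpace ℝ H] :
    (V →L[ℝ] F →L[ℝ] H) →L[ℝ] F →L[ℝ] V →L[ℝ] H :=
  (ContinuousLinearMap.flipₗᵢ ℝ V F H).toContinuousLinearEquiv

@[simp] lemma flipCLM_apply {H : Type*} [NormedAddCommGroup H] [NormedSpace ℝ H]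
    (T : V →L[ℝ] F →L[ℝ] H) : flipCLM V F H T = T.flip := rfl

/-- A solution of a linear total differential equation with `C^m` coefficients is of class `C^{m+1}`:
the equation expresses its derivative through the coefficients and the solution itself. -/
lemma contDiffOn_of_fderiv_eq_flip {L : V → V →L[ℝ] F →L[ℝ] F} {Ω : Set V} (hΩ : IsOpen Ω)
    {m : ℕ} (hL : ContDiffOn ℝ m L Ω) {f : V → F}
    (hf : ∀ x ∈ Ω, HasFDerivAt f ((L x).flip (f x)) x) : ContDiffOn ℝ (m + 1 : ℕ) f Ω := by
  have key : ∀ j : ℕ, j ≤ m → ContDiffOn ℝ j f Ω → ContDiffOn ℝ (j + 1 : ℕ) f Ω := by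
    intro j hj hfj
    rw [Nat.cast_add, Nat.cast_one, contDiffOn_succ_iff_fderiv_of_isOpen hΩ]
    refine ⟨fun x hx ↦ (hf x hx).differentiableAt.differentiableWithinAt, by simp, ?_⟩
    have h1 : ContDiffOn ℝ j (fun x ↦ (L x).flip (f x)) Ω := by
      have hφ : ContDiff ℝ j (flipCLM V F F) := (flipCLM V F F).contDiff
      have h2 : ContDiffOn ℝ j (fun x ↦ (L x).flip) Ω :=
        hφ.comp_contDiffOn (hL.of_le (Nat.cast_le.2 hj))
      exact h2.clm_apply hfj
    exact h1.congr fun x hx ↦ (hf x hx).fderiv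
  have all : ∀ j : ℕ, j ≤ m + 1 → ContDiffOn ℝ j f Ω := by
    intro j
    induction j with
    | zero =>
      intro _
      exact contDiffOn_zero.2 fun x hx ↦ (hf x hx).continuousAt.continuousWithinAt
    | succ j ih => exact fun hj ↦ key j (by omega) (ih (by omega))
  exact all _ le_rfl

/-- Along a solution the integrability condition holds automatically, by the symmetry of the second
derivative. -/
lemma integrability_of_hasFDerivAt {L : V → V →L[ℝ] F →L[ℝ] F} {x : V}
    (hL : DifferentiableAt ℝ L x) {f : V → F}
    (hf : ∀ᶠ y in 𝓝 x, HasFDerivAt f ((L y).flip (f y)) y) (u v : V) :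
    fderiv ℝ L x u v (f x) + L x v (L x u (f x)) =
      fderiv ℝ L x v u (f x) + L x u (L x v (f x)) := by
  have hfx := hf.self_of_nhds
  have hφ : HasFDerivAt (flipCLM V F F) (flipCLM V F F) (L x) := (flipCLM V F F).hasFDerivAt
  have h1 : HasFDerivAt (fun y ↦ (L y).flip) (flipCLM V F F ∘L fderiv ℝ L x) x :=
    hφ.comp x hL.hasFDerivAt
  have h2 := h1.clm_apply hfx
  have := second_derivative_symmetric_of_eventually hf h2 u v
  simpa [add_comm] using this

/-- Uniqueness for a linear total differential equation on a ball. -/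
lemma eqOn_zero_of_hasFDerivAt {L : V → V →L[ℝ] F →L[ℝ] F} {x₀ : V} {r : ℝ}
    (hL : ContinuousOn L (ball x₀ r)) {f : V → F}
    (hf : ∀ x ∈ ball x₀ r, HasFDerivAt f ((L x).flip (f x)) x) (h0 : f x₀ = 0) :
    ∀ x ∈ ball x₀ r, f x = 0 := by
  intro x hx
  have hr : 0 < r := pos_of_mem_ball hx
  have hmem : ∀ t ∈ Icc (0 : ℝ) 1, x₀ + t • (x - x₀) ∈ ball x₀ r := fun t ht ↦ by
    have := (convex_ball x₀ r).add_smul_sub_mem (mem_ball_self hr) hx ht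
    simpa using this
  have hc : ContinuousOn (fun t : ℝ ↦ L (x₀ + t • (x - x₀)) (x - x₀)) (Icc 0 1) := by
    have h1 : ContinuousOn (fun t : ℝ ↦ L (x₀ + t • (x - x₀))) (Icc 0 1) :=
      hL.comp (by fun_prop) hmem
    exact h1.clm_apply continuousOn_const
  obtain ⟨K, hK⟩ := isCompact_Icc.exists_bound_of_continuousOn hc
  have hd : ∀ t ∈ Icc (0 : ℝ) 1, HasDerivAt (fun t : ℝ ↦ f (x₀ + t • (x - x₀)))
      (L (x₀ + t • (x - x₀)) (x - x₀) (f (x₀ + t • (x - x₀)))) t := by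
    intro t ht
    have h1 : HasDerivAt (fun t : ℝ ↦ x₀ + t • (x - x₀)) (x - x₀) t := by
      simpa using ((hasDerivAt_id t).smul_const (x - x₀)).const_add x₀
    simpa [Function.comp_def] using (hf _ (hmem t ht)).comp_hasDerivAt t h1
  have := eq_zero_of_abs_deriv_le_mul_abs_self_of_eq_zero_right (K := K)
    (f := fun t : ℝ ↦ f (x₀ + t • (x - x₀))) (a := 0) (b := 1)
    (fun t ht ↦ (hd t ht).continuousAt.continuousWithinAt)
    (fun t ht ↦ (hd t (Ico_subset_Icc_self ht)).hasDerivWithinAt) (by simpa using h0)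
    (fun t ht ↦ ((L (x₀ + t • (x - x₀)) (x - x₀)).le_opNorm _).trans
      (by gcongr; exact hK t (Ico_subset_Icc_self ht))) 1 (by simp)
  simpa using this

/-- Solutions of a linear ODE on `[0, 1]` with small coefficients. By the bound `1 / 2` the solution
does not leave the ball of radius `‖f₀‖` around `f₀`, so that the Picard–Lindelöf theorem gives a
solution on all of `[0, 1]`. -/
lemma exists_linear_ode_solution [CompleteSpace F] {B : ℝ → F →L[ℝ] F}
    (hB : ContinuousOn B (Icc 0 1)) (hB' : ∀ t ∈ Icc (0 : ℝ) 1, ‖B t‖ ≤ 1 / 2) (f₀ : F) :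
    ∃ α : ℝ → F, α 0 = f₀ ∧ ∀ t ∈ Icc (0 : ℝ) 1, HasDerivWithinAt α (B t (α t)) (Icc 0 1) t := by
  have hP : IsPicardLindelof (fun t a ↦ B t a) (tmin := 0) (tmax := 1) ⟨0, by simp⟩ f₀
      ‖f₀‖₊ 0 ‖f₀‖₊ (1 / 2) := by
    refine ⟨fun t ht ↦ ?_, fun a _ ↦ hB.clm_apply continuousOn_const, fun t ht a ha ↦ ?_, ?_⟩
    · exact ((B t).lipschitz.weaken (by exact_mod_cast hB' t ht)).lipschitzOnWith
    · have h1 : ‖a‖ ≤ 2 * ‖f₀‖ := by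
        have := norm_le_of_mem_closedBall ha
        simp at this; linarith
      calc ‖B t a‖ ≤ ‖B t‖ * ‖a‖ := (B t).le_opNorm a
        _ ≤ 1 / 2 * (2 * ‖f₀‖) := by gcongr; exact hB' t ht
        _ = _ := by simp
    · simp
  obtain ⟨α, h0, h1⟩ := hP.exists_eq_forall_mem_Icc_hasDerivWithinAt₀
  exact ⟨α, h0, h1⟩

/-- A `C^1` map is differentiable uniformly on compact sets. -/
lemma eventually_forall_norm_sub_fderiv_le {L : V → F} {K : Set V} (hK : IsCompact K)
    (hL : ∀ z ∈ K, ContDiffAt ℝ 1 L z) {ε : ℝ} (hε : 0 < ε) :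
    ∀ᶠ k in 𝓝 (0 : V), ∀ z ∈ K, ‖L (z + k) - L z - fderiv ℝ L z k‖ ≤ ε * ‖k‖ ∧
      ‖L (z + k) - L z‖ ≤ ε := by
  refine hK.eventually_forall_of_forall_eventually fun z₀ hz₀ ↦ ?_
  have hadd : Tendsto (fun p : V × V ↦ p.2 + p.1) (𝓝 (0, z₀)) (𝓝 z₀) := by
    have : Continuous fun p : V × V ↦ p.2 + p.1 := by fun_prop
    simpa using this.tendsto (0, z₀)
  have hfst : Tendsto (fun p : V × V ↦ p.2) (𝓝 (0, z₀)) (𝓝 z₀) := continuous_snd.tendsto (0, z₀)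
  have hstr := (hL z₀ hz₀).hasStrictFDerivAt one_ne_zero
  have h1 := (hadd.prodMk_nhds hfst).eventually
    ((Asymptotics.isLittleO_iff.1 hstr.isLittleO) (half_pos hε))
  have hcont : ContinuousAt (fderiv ℝ L) z₀ :=
    ((hL z₀ hz₀).fderiv_right (m := 0) (by simp)).continuousAt
  have h2 := hfst.eventually (Metric.continuousAt_iff'.1 hcont _ (half_pos hε))
  have h3 : Tendsto (fun p : V × V ↦ L (p.2 + p.1) - L p.2) (𝓝 (0, z₀)) (𝓝 0) := by
    have hc := (hL z₀ hz₀).continuousAt.tendsto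
    simpa using (hc.comp hadd).sub (hc.comp hfst)
  have h4 := h3.eventually (Metric.ball_mem_nhds 0 hε)
  filter_upwards [h1, h2, h4] with p hp1 hp2 hp4
  refine ⟨?_, by simpa using (mem_ball_zero_iff.1 hp4).le⟩
  have e : L (p.2 + p.1) - L p.2 - fderiv ℝ L p.2 p.1 =
      (L (p.2 + p.1) - L p.2 - fderiv ℝ L z₀ p.1) - (fderiv ℝ L p.2 - fderiv ℝ L z₀) p.1 := by
    simp
  rw [e]
  have hp1' : ‖L (p.2 + p.1) - L p.2 - fderiv ℝ L z₀ p.1‖ ≤ ε / 2 * ‖p.1‖ := by simpa using hp1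
  have hp2' : ‖(fderiv ℝ L p.2 - fderiv ℝ L z₀) p.1‖ ≤ ε / 2 * ‖p.1‖ :=
    (ContinuousLinearMap.le_opNorm _ _).trans (by gcongr; rw [← dist_eq_norm]; exact hp2.le)
  calc _ ≤ _ := norm_sub_le _ _
    _ ≤ ε / 2 * ‖p.1‖ + ε / 2 * ‖p.1‖ := add_le_add hp1' hp2'
    _ = _ := by ring

/-- The local existence theorem for integrable linear total differential equations, at the base point
`0`. The solution is
obtained by solving the ordinary differential equations along the rays from the base point; the
integrability condition shows that `α_{y+h}(t) - α_y(t) - L(ty)(th) α_y(t)`, where `α_y` is the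
solution along the ray to `y`, satisfies a linear equation up to an error `o(h)`, so that it is
`o(h)` by Grönwall's inequality. -/
theorem exists_hasFDerivAt_of_integrable_zero [CompleteSpace F] {L : V → V →L[ℝ] F →L[ℝ] F}
    {Ω : Set V} (hΩ : IsOpen Ω) (hL : ContDiffOn ℝ 1 L Ω) (hint : ∀ x ∈ Ω, IsIntegrableAt L x)
    (h0 : (0 : V) ∈ Ω) (f₀ : F) :
    ∃ r > 0, ball 0 r ⊆ Ω ∧ ∃ f : V → F, f 0 = f₀ ∧
      ∀ x ∈ ball 0 r, HasFDerivAt f ((L x).flip (f x)) x := by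
  set C := ‖L 0‖ + 1 with hCdef
  have hC : 0 < C := by positivity
  have hLat : ∀ x ∈ Ω, ContDiffAt ℝ 1 L x := fun x hx ↦ hL.contDiffAt (hΩ.mem_nhds hx)
  obtain ⟨r, hr, hrΩ, hrC, hrC'⟩ : ∃ r > 0, ball 0 r ⊆ Ω ∧ (∀ x ∈ ball (0 : V) r, ‖L x‖ ≤ C) ∧
      C * r ≤ 1 / 2 := by
    have hn : ContinuousAt (fun x ↦ ‖L x‖) 0 := continuous_norm.continuousAt.comp
      (hLat 0 h0).continuousAt
    have hev : ∀ᶠ x in 𝓝 (0 : V), x ∈ Ω ∧ ‖L x‖ < C :=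
      (hΩ.eventually_mem h0).and (hn.eventually_lt_const (by simp [C]))
    obtain ⟨r, hr, hball⟩ := Metric.eventually_nhds_iff_ball.1 hev
    refine ⟨min r (1 / 2 / C), by positivity, fun x hx ↦ ?_, fun x hx ↦ ?_, ?_⟩
    · exact (hball x (ball_subset_ball (min_le_left _ _) hx)).1
    · exact (hball x (ball_subset_ball (min_le_left _ _) hx)).2.le
    · calc C * min r (1 / 2 / C) ≤ C * (1 / 2 / C) := by gcongr; exact min_le_right _ _
        _ = 1 / 2 := by field_simp
  have hmem : ∀ y ∈ ball (0 : V) r, ∀ t ∈ Icc (0 : ℝ) 1, t • y ∈ ball (0 : V) r := fun y hy t ht ↦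
    (convex_ball (0 : V) r).smul_mem_of_zero_mem (mem_ball_self hr) hy ht
  have hBle : ∀ y ∈ ball (0 : V) r, ∀ t ∈ Icc (0 : ℝ) 1, ‖L (t • y) y‖ ≤ 1 / 2 :=
    fun y hy t ht ↦ calc
      ‖L (t • y) y‖ ≤ ‖L (t • y)‖ * ‖y‖ := (L _).le_opNorm _
      _ ≤ C * r := mul_le_mul (hrC _ (hmem y hy t ht)) (mem_ball_zero_iff.1 hy).le
        (norm_nonneg _) hC.le
      _ ≤ 1 / 2 := hrC'
  have hex : ∀ y : V, ∃ α : ℝ → F, y ∈ ball (0 : V) r → α 0 = f₀ ∧ ∀ t ∈ Icc (0 : ℝ) 1,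
      HasDerivWithinAt α (L (t • y) y (α t)) (Icc 0 1) t := by
    intro y
    by_cases hy : y ∈ ball (0 : V) r
    · have hc : ContinuousOn (fun t : ℝ ↦ L (t • y) y) (Icc 0 1) := by
        have h1 : ContinuousOn (fun t : ℝ ↦ L (t • y)) (Icc 0 1) :=
          hL.continuousOn.comp (by fun_prop) fun t ht ↦ hrΩ (hmem y hy t ht)
        exact h1.clm_apply continuousOn_const
      obtain ⟨α, h⟩ := exists_linear_ode_solution hc (hBle y hy) f₀
      exact ⟨α, fun _ ↦ h⟩
    · exact ⟨0, fun h ↦ absurd h hy⟩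
  choose α hα using hex
  have hIci : ∀ {β : ℝ → F} {β' : F} {t : ℝ}, t ∈ Ico (0 : ℝ) 1 →
      HasDerivWithinAt β β' (Icc 0 1) t → HasDerivWithinAt β β' (Ici t) t := fun ht h ↦
    h.mono_of_mem_nhdsWithin (mem_of_superset (Icc_mem_nhdsGE ht.2) (Icc_subset_Icc_left ht.1))
  refine ⟨r, hr, hrΩ, fun y ↦ α y 1, ?_, fun y hy ↦ ?_⟩
  · have h := hα 0 (mem_ball_self hr)
    have := constant_of_derivWithin_zero (f := α 0) (a := 0) (b := 1)
      (fun t ht ↦ (h.2 t ht).differentiableWithinAt) fun t ht ↦ by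
        have := (h.2 t (Ico_subset_Icc_self ht)).derivWithin
          (uniqueDiffOn_Icc_zero_one t (Ico_subset_Icc_self ht))
        simpa using this
    rw [← h.1]
    exact this 1 (by simp)
  obtain ⟨M, hM⟩ := isCompact_Icc.exists_bound_of_continuousOn
    (fun t ht ↦ ((hα y hy).2 t ht).continuousWithinAt)
  have hM0 : 0 ≤ M := (norm_nonneg _).trans (hM 0 (by simp))
  rw [hasFDerivAt_iff_isLittleO_nhds_zero, Asymptotics.isLittleO_iff]
  intro c hc
  -- `ε * D * ‖h‖` bounds the error term `ρ` below, and Grönwall's inequality with the Lipschitz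
  -- constant `1 / 2` multiplies it by `2 * (exp (1 / 2) - 1) ≤ 2`
  set D := M * (‖y‖ + 1 + C * ‖y‖ + C * C) + 1 with hD
  have hD0 : 0 < D := by positivity
  obtain ⟨ε, hε, hεc⟩ : ∃ ε > 0, 2 * (ε * D) ≤ c := ⟨c / (2 * D), by positivity, by
    have : D ≠ 0 := hD0.ne'
    rw [show 2 * (c / (2 * D) * D) = c by field_simp]⟩
  have hKc : IsCompact ((fun t : ℝ ↦ t • y) '' Icc 0 1) := isCompact_Icc.image (by fun_prop)
  have hev := eventually_forall_norm_sub_fderiv_le hKc (L := L) (by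
    rintro _ ⟨t, ht, rfl⟩
    exact hLat _ (hrΩ (hmem y hy t ht))) hε
  obtain ⟨η, hη, hev⟩ := Metric.eventually_nhds_iff_ball.1 hev
  have hyh : ∀ᶠ h in 𝓝 (0 : V), y + h ∈ ball (0 : V) r := by
    have : Tendsto (fun h ↦ y + h) (𝓝 0) (𝓝 y) := by
      simpa using (by fun_prop : Continuous fun h : V ↦ y + h).tendsto 0
    exact this.eventually (isOpen_ball.mem_nhds hy)
  filter_upwards [hyh, ball_mem_nhds (0 : V) hη, ball_mem_nhds (0 : V) hε] with h hh hhη hhε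
  obtain ⟨hα0, hαd⟩ := hα y hy
  obtain ⟨hβ0, hβd⟩ := hα (y + h) hh
  set a := α y
  set b := α (y + h)
  set δ : ℝ → F := fun t ↦ b t - a t - L (t • y) (t • h) (a t) with hδ
  -- the error term in the equation for `δ`
  set ρ : ℝ → F := fun t ↦
    (L (t • y + t • h) - L (t • y) - fderiv ℝ L (t • y) (t • h)) y (a t)
      + (L (t • y + t • h) - L (t • y)) h (a t)
      + (L (t • y + t • h) (y + h) - L (t • y) y) (L (t • y) (t • h) (a t)) with hρ
  have hδd : ∀ t ∈ Icc (0 : ℝ) 1,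
      HasDerivWithinAt δ (L (t • (y + h)) (y + h) (δ t) + ρ t) (Icc 0 1) t := by
    intro t ht
    have hz := hrΩ (hmem y hy t ht)
    have hLd := ((hLat _ hz).differentiableAt one_ne_zero).hasFDerivAt
    have h1 : HasDerivAt (fun t : ℝ ↦ t • y) y t := by
      simpa using (hasDerivAt_id t).smul_const y
    have h2 : HasDerivAt (fun t : ℝ ↦ t • h) h t := by
      simpa using (hasDerivAt_id t).smul_const h
    have h3 : HasDerivAt (fun t : ℝ ↦ L (t • y)) (fderiv ℝ L (t • y) y) t :=
      HasFDerivAt.comp_hasDerivAt (f := fun t : ℝ ↦ t • y) t hLd h1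
    have h4 := (h3.clm_apply h2).hasDerivWithinAt.clm_apply (hαd t ht)
    have h5 := ((hβd t ht).sub (hαd t ht)).sub h4
    refine h5.congr_deriv ?_
    -- integrability replaces `D_y L (t h)` by `D_{t h} L (y)`, which `ρ` accounts for
    have hfl := hint _ hz y (t • h) (a t)
    simp only [hδ, hρ, smul_add, _root_.sub_apply, _root_.add_apply,
      map_sub, map_add] at hfl ⊢
    have hfl' := eq_sub_of_add_eq hfl
    rw [hfl']
    abel
  have hρle : ∀ t ∈ Icc (0 : ℝ) 1, ‖ρ t‖ ≤ ε * D * ‖h‖ := by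
    intro t ht
    have hth : ‖t • h‖ ≤ ‖h‖ := by
      rw [norm_smul, Real.norm_of_nonneg ht.1]
      exact mul_le_of_le_one_left (norm_nonneg _) ht.2
    have hthη : t • h ∈ ball (0 : V) η := by
      rw [mem_ball_zero_iff] at hhη ⊢; exact hth.trans_lt hhη
    obtain ⟨e1, e2⟩ := hev _ hthη (t • y) ⟨t, ht, rfl⟩
    have hat := hM t ht
    have hLz := hrC _ (hmem y hy t ht)
    have hLzk := hrC _ (hmem _ hh t ht)
    rw [smul_add] at hLzk
    have hhε' : ‖h‖ ≤ ε := (mem_ball_zero_iff.1 hhε).le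
    have t1 : ‖(L (t • y + t • h) - L (t • y) - fderiv ℝ L (t • y) (t • h)) y (a t)‖
        ≤ ε * ‖h‖ * ‖y‖ * M :=
      (ContinuousLinearMap.le_opNorm₂ _ _ _).trans (by gcongr; exact e1.trans (by gcongr))
    have t2 : ‖(L (t • y + t • h) - L (t • y)) h (a t)‖ ≤ ε * ‖h‖ * M :=
      (ContinuousLinearMap.le_opNorm₂ _ _ _).trans (by gcongr)
    have t3 : ‖L (t • y + t • h) (y + h) - L (t • y) y‖ ≤ ε * ‖y‖ + C * ε := by
      have : L (t • y + t • h) (y + h) - L (t • y) y =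
        (L (t • y + t • h) - L (t • y)) y + L (t • y + t • h) h := by
        simp only [map_add, _root_.sub_apply]; abel
      rw [this]
      refine (norm_add_le _ _).trans (add_le_add ?_ ?_)
      · exact (ContinuousLinearMap.le_opNorm _ _).trans (by gcongr)
      · exact (ContinuousLinearMap.le_opNorm _ _).trans (by gcongr)
    have t4 : ‖L (t • y) (t • h) (a t)‖ ≤ C * ‖h‖ * M :=
      (ContinuousLinearMap.le_opNorm₂ _ _ _).trans (by gcongr)
    have t5 : ‖(L (t • y + t • h) (y + h) - L (t • y) y) (L (t • y) (t • h) (a t))‖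
        ≤ (ε * ‖y‖ + C * ε) * (C * ‖h‖ * M) :=
      (ContinuousLinearMap.le_opNorm _ _).trans (by gcongr)
    calc ‖ρ t‖ ≤ ε * ‖h‖ * ‖y‖ * M + ε * ‖h‖ * M + (ε * ‖y‖ + C * ε) * (C * ‖h‖ * M) :=
        (norm_add₃_le).trans (by gcongr)
      _ = ε * (D - 1) * ‖h‖ := by rw [hD]; ring
      _ ≤ ε * D * ‖h‖ := by gcongr; linarith
  have hgr := norm_le_gronwallBound_of_norm_deriv_right_le (f := δ) (a := 0) (b := 1) (δ := 0)
    (K := 1 / 2) (ε := ε * D * ‖h‖) (fun t ht ↦ (hδd t ht).continuousWithinAt)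
    (fun t ht ↦ hIci ht (hδd t (Ico_subset_Icc_self ht))) (by simp [hδ, hα0, hβ0])
    (fun t ht ↦ by
      have ht' := Ico_subset_Icc_self ht
      refine (norm_add_le _ _).trans (add_le_add ?_ (hρle t ht'))
      exact (ContinuousLinearMap.le_opNorm _ _).trans (by gcongr; exact hBle _ hh t ht')) 1
    (by simp)
  have hexp : Real.exp (1 / 2) ≤ 2 := by
    have h1 := Real.exp_one_lt_d9
    have h2 : Real.exp (1 / 2) ^ 2 = Real.exp 1 := by rw [← Real.exp_nat_mul]; norm_num
    nlinarith [Real.exp_pos (1 / 2)]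
  rw [gronwallBound_of_K_ne_0 (by norm_num)] at hgr
  have hfin : ‖δ 1‖ ≤ c * ‖h‖ := calc
    ‖δ 1‖ ≤ _ := hgr
    _ = 2 * (ε * D * ‖h‖) * (Real.exp (1 / 2) - 1) := by simp only [sub_zero, mul_one]; ring
    _ ≤ 2 * (ε * D * ‖h‖) * 1 := by gcongr; linarith
    _ = 2 * (ε * D) * ‖h‖ := by ring
    _ ≤ c * ‖h‖ := by gcongr
  simpa [hδ] using hfin

/-- The local existence theorem for integrable linear total differential equations, at any base
point. -/
theorem exists_hasFDerivAt_of_integrable [CompleteSpace F] {L : V → V →L[ℝ] F →L[ℝ] F}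
    {Ω : Set V} (hΩ : IsOpen Ω) (hL : ContDiffOn ℝ 1 L Ω) (hint : ∀ x ∈ Ω, IsIntegrableAt L x)
    {x₀ : V} (h0 : x₀ ∈ Ω) (f₀ : F) :
    ∃ r > 0, ball x₀ r ⊆ Ω ∧ ∃ f : V → F, f x₀ = f₀ ∧
      ∀ x ∈ ball x₀ r, HasFDerivAt f ((L x).flip (f x)) x := by
  obtain ⟨r, hr, hsub, f, hf0, hf⟩ := exists_hasFDerivAt_of_integrable_zero
    (L := fun x ↦ L (x + x₀)) (Ω := (fun x ↦ x + x₀) ⁻¹' Ω) (hΩ.preimage (by fun_prop))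
    (hL.comp (by fun_prop) fun x hx ↦ hx) (fun x hx u v w ↦ by
      have := fderiv_comp_add_right (𝕜 := ℝ) (f := L) (x := x) x₀
      rw [this]
      exact hint _ hx u v w) (by simpa using h0) f₀
  refine ⟨r, hr, fun x hx ↦ ?_, fun x ↦ f (x - x₀), by simpa using hf0, fun x hx ↦ ?_⟩
  · have := hsub (a := x - x₀) (by simpa [dist_eq_norm] using hx)
    simpa using this
  · have := hf (x - x₀) (by simpa [dist_eq_norm] using hx)
    simp only [sub_add_cancel] at this
    simpa [Function.comp_def] using this.comp x ((hasFDerivAt_id x).sub_const x₀)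

end LinearPDE

/-! ### Connections and curvature on a normed space -/

section Connection

variable {V : Type*} [NormedAddCommGroup V] [NormedSpace ℝ V]

/-- The curvature of the connection `∇_u W = D_u W + Γ(u, W)` on the normed space `V`:
`R(u, v) w = D_u Γ(v, w) - D_v Γ(u, w) + Γ(u, Γ(v, w)) - Γ(v, Γ(u, w))`. -/
def curvature (Γ : V → V →L[ℝ] V →L[ℝ] V) (x : V) : V →L[ℝ] V →L[ℝ] V →L[ℝ] V :=
  fderiv ℝ Γ x - flipCLM V V (V →L[ℝ] V) (fderiv ℝ Γ x)
    + (((ContinuousLinearMap.compL ℝ V V V).flip ∘L Γ x).flip ∘L Γ x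
      - flipCLM V V (V →L[ℝ] V) (((ContinuousLinearMap.compL ℝ V V V).flip ∘L Γ x).flip ∘L Γ x))

lemma curvature_apply (Γ : V → V →L[ℝ] V →L[ℝ] V) (x u v w : V) :
    curvature Γ x u v w = fderiv ℝ Γ x u v w - fderiv ℝ Γ x v u w
      + (Γ x u (Γ x v w) - Γ x v (Γ x u w)) := by
  simp [curvature]

lemma contDiffOn_curvature {Γ : V → V →L[ℝ] V →L[ℝ] V} {Ω : Set V} (hΩ : IsOpen Ω) {m : ℕ}
    (hΓ : ContDiffOn ℝ (m + 1 : ℕ) Γ Ω) : ContDiffOn ℝ m (curvature Γ) Ω := by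
  have h1 : ContDiffOn ℝ m (fderiv ℝ Γ) Ω := hΓ.fderiv_of_isOpen hΩ (by exact_mod_cast le_rfl)
  have h0 : ContDiffOn ℝ m Γ Ω := hΓ.of_le (by exact_mod_cast Nat.le_succ m)
  have h2 : ContDiffOn ℝ m
      (fun x ↦ ((ContinuousLinearMap.compL ℝ V V V).flip ∘L Γ x).flip ∘L Γ x) Ω := by
    have h3 : ContDiffOn ℝ m (fun x ↦ ((ContinuousLinearMap.compL ℝ V V V).flip ∘L Γ x)) Ω :=
      contDiffOn_const.clm_comp h0
    exact ((flipCLM V (V →L[ℝ] V) (V →L[ℝ] V)).contDiff.comp_contDiffOn h3).clm_comp h0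
  exact (h1.sub ((flipCLM V V (V →L[ℝ] V)).contDiff.comp_contDiffOn h1)).add
    (h2.sub ((flipCLM V V (V →L[ℝ] V)).contDiff.comp_contDiffOn h2))

/-- The coefficients of the equation `D_u A = A ∘ Γ(u, ·)` satisfied by the derivative `A` of flat
coordinates. -/
def coframeCoeff (Γ : V → V →L[ℝ] V →L[ℝ] V) (x : V) : V →L[ℝ] (V →L[ℝ] V) →L[ℝ] (V →L[ℝ] V) :=
  (ContinuousLinearMap.compL ℝ V V V).flip ∘L Γ x

@[simp] lemma coframeCoeff_apply (Γ : V → V →L[ℝ] V →L[ℝ] V) (x u : V) (A : V →L[ℝ] V) :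
    coframeCoeff Γ x u A = A ∘L Γ x u := rfl

lemma contDiffOn_coframeCoeff {Γ : V → V →L[ℝ] V →L[ℝ] V} {Ω : Set V} {m : ℕ∞ω}
    (hΓ : ContDiffOn ℝ m Γ Ω) : ContDiffOn ℝ m (coframeCoeff Γ) Ω :=
  contDiffOn_const.clm_comp hΓ

lemma isIntegrableAt_coframeCoeff {Γ : V → V →L[ℝ] V →L[ℝ] V} {x : V}
    (hΓ : DifferentiableAt ℝ Γ x) (h : curvature Γ x = 0) :
    IsIntegrableAt (coframeCoeff Γ) x := by
  intro u v A
  have hd : HasFDerivAt (coframeCoeff Γ)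
      ((ContinuousLinearMap.compL ℝ V _ _ (ContinuousLinearMap.compL ℝ V V V).flip) ∘L
        fderiv ℝ Γ x) x :=
    (ContinuousLinearMap.compL ℝ V _ _
      (ContinuousLinearMap.compL ℝ V V V).flip).hasFDerivAt.comp x hΓ.hasFDerivAt
  rw [hd.fderiv]
  ext w
  have := congr(A ($h u v w))
  rw [curvature_apply] at this
  simp only [map_add, map_sub, zero_apply, map_zero] at this
  simp only [ContinuousLinearMap.comp_apply, ContinuousLinearMap.compL_apply,
    ContinuousLinearMap.flip_apply, _root_.add_apply, coframeCoeff_apply]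
  linear_combination (norm := module) this

/-- A parallel vector field is annihilated by the curvature. -/
lemma curvature_apply_eq_zero_of_parallel {Γ : V → V →L[ℝ] V →L[ℝ] V} {x : V}
    (hΓ : DifferentiableAt ℝ Γ x) {W : V → V}
    (hW : ∀ᶠ y in 𝓝 x, HasFDerivAt W (-(Γ y).flip (W y)) y) (u v : V) :
    curvature Γ x u v (W x) = 0 := by
  have := integrability_of_hasFDerivAt (L := fun y ↦ -Γ y) hΓ.neg
    (hW.mono fun y hy ↦ hy.congr_fderiv (by ext; simp)) u v
  rw [fderiv_fun_neg] at this
  rw [curvature_apply]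
  simp only [_root_.neg_apply, map_neg, neg_neg] at this
  linear_combination (norm := module) -this

/-- The Koszul formula: `Γ(x)` is the Christoffel form of the metric `G` at `x`. -/
def SatisfiesKoszul (G : V → V →L[ℝ] V →L[ℝ] ℝ) (Γ : V → V →L[ℝ] V →L[ℝ] V) (x : V) : Prop :=
  ∀ u v w, 2 * G x (Γ x u v) w =
    fderiv ℝ G x u v w + fderiv ℝ G x v u w - fderiv ℝ G x w u v

lemma fderiv_apply_symm {G : V → V →L[ℝ] V →L[ℝ] ℝ} {x : V} (hG : DifferentiableAt ℝ G x)
    (hs : ∀ᶠ y in 𝓝 x, ∀ v w, G y v w = G y w v) (u v w : V) :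
    fderiv ℝ G x u v w = fderiv ℝ G x u w v := by
  have key : ∀ v w : V, HasFDerivAt (fun y ↦ G y v w)
      ((ContinuousLinearMap.apply ℝ ℝ w ∘L ContinuousLinearMap.apply ℝ (V →L[ℝ] ℝ) v) ∘L
        fderiv ℝ G x) x := fun v w ↦
    (ContinuousLinearMap.apply ℝ ℝ w ∘L
      ContinuousLinearMap.apply ℝ (V →L[ℝ] ℝ) v).hasFDerivAt.comp x hG.hasFDerivAt
  have := ((key v w).congr_of_eventuallyEq (hs.mono fun y hy ↦ hy w v)).unique (key w v)
  simpa using congr($this u)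

namespace SatisfiesKoszul

variable {G : V → V →L[ℝ] V →L[ℝ] ℝ} {Γ : V → V →L[ℝ] V →L[ℝ] V} {x : V}

lemma symm (h : SatisfiesKoszul G Γ x) (hG : DifferentiableAt ℝ G x)
    (hs : ∀ᶠ y in 𝓝 x, ∀ v w, G y v w = G y w v) (hn : ∀ v, (∀ w, G x v w = 0) → v = 0)
    (u v : V) : Γ x u v = Γ x v u := by
  rw [← sub_eq_zero]
  refine hn _ fun w ↦ ?_
  have h1 := h u v w
  have h2 := h v u w
  have h3 := fderiv_apply_symm hG hs w u v
  simp only [map_sub, _root_.sub_apply]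
  linarith

lemma compatible (h : SatisfiesKoszul G Γ x) (hG : DifferentiableAt ℝ G x)
    (hs : ∀ᶠ y in 𝓝 x, ∀ v w, G y v w = G y w v) (u v w : V) :
    fderiv ℝ G x u v w = G x (Γ x u v) w + G x v (Γ x u w) := by
  have h1 := h u v w
  have h2 := h u w v
  have h3 := fderiv_apply_symm hG hs u v w
  rw [hs.self_of_nhds v]
  linarith

/-- The transformation law of the Christoffel form under a local isometry `ψ`. -/
lemma transform (h : SatisfiesKoszul G Γ x) {G' : V → V →L[ℝ] V →L[ℝ] ℝ}
    {Γ' : V → V →L[ℝ] V →L[ℝ] V} {ψ : V → V} (h' : SatisfiesKoszul G' Γ' (ψ x))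
    (hψ : ContDiffAt ℝ 2 ψ x) (hG' : DifferentiableAt ℝ G' (ψ x)) (hG : DifferentiableAt ℝ G x)
    (hs : ∀ v w, G' (ψ x) v w = G' (ψ x) w v) (hn : ∀ v, (∀ w, G' (ψ x) v w = 0) → v = 0)
    (hA : Function.Surjective (fderiv ℝ ψ x))
    (hiso : ∀ᶠ y in 𝓝 x, ∀ v w, G y v w = G' (ψ y) (fderiv ℝ ψ y v) (fderiv ℝ ψ y w)) (u v : V) :
    Γ' (ψ x) (fderiv ℝ ψ x u) (fderiv ℝ ψ x v) + fderiv ℝ (fderiv ℝ ψ) x u v =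
      fderiv ℝ ψ x (Γ x u v) := by
  have hψd : HasFDerivAt ψ (fderiv ℝ ψ x) x := (hψ.differentiableAt two_ne_zero).hasFDerivAt
  have hψ2 : HasFDerivAt (fderiv ℝ ψ) (fderiv ℝ (fderiv ℝ ψ) x) x :=
    ((hψ.fderiv_right (m := 1) (by norm_num)).differentiableAt one_ne_zero).hasFDerivAt
  have hsym : ∀ a b, fderiv ℝ (fderiv ℝ ψ) x a b = fderiv ℝ (fderiv ℝ ψ) x b a :=
    (hψ.isSymmSndFDerivAt (by simp)).eq
  have key : ∀ a b c, fderiv ℝ G x a b c =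
      fderiv ℝ G' (ψ x) (fderiv ℝ ψ x a) (fderiv ℝ ψ x b) (fderiv ℝ ψ x c)
      + G' (ψ x) (fderiv ℝ (fderiv ℝ ψ) x a b) (fderiv ℝ ψ x c)
      + G' (ψ x) (fderiv ℝ ψ x b) (fderiv ℝ (fderiv ℝ ψ) x a c) := by
    intro a b c
    have h1 := (hG.hasFDerivAt.clm_apply (hasFDerivAt_const b x)).clm_apply (hasFDerivAt_const c x)
    have h2 := ((hG'.hasFDerivAt.comp x hψd).clm_apply
      (hψ2.clm_apply (hasFDerivAt_const b x))).clm_apply (hψ2.clm_apply (hasFDerivAt_const c x))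
    have := (h1.congr_of_eventuallyEq (hiso.mono fun y hy ↦ (hy b c).symm)).unique h2
    have := congr($this a)
    simp at this
    linarith
  rw [← sub_eq_zero]
  refine hn _ fun w' ↦ ?_
  obtain ⟨w, rfl⟩ := hA w'
  have e1 := h u v w
  have e2 := h' (fderiv ℝ ψ x u) (fderiv ℝ ψ x v) (fderiv ℝ ψ x w)
  rw [key u v w, key v u w, key w u v, hiso.self_of_nhds] at e1
  simp only [map_sub, map_add, _root_.sub_apply, _root_.add_apply]
  rw [hsym v u, hsym w u, hsym w v, hs (fderiv ℝ (fderiv ℝ ψ) x u w)] at e1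
  linarith

end SatisfiesKoszul

/-- The curvature is a tensor: it is compatible with every map `ψ` that relates the Christoffel
forms by the transformation law. -/
lemma curvature_transform {Γ Γ' : V → V →L[ℝ] V →L[ℝ] V} {ψ : V → V} {x : V}
    (hψ : ContDiffAt ℝ 3 ψ x) (hΓ : DifferentiableAt ℝ Γ x) (hΓ' : DifferentiableAt ℝ Γ' (ψ x))
    (h : ∀ᶠ y in 𝓝 x, ∀ u v, Γ' (ψ y) (fderiv ℝ ψ y u) (fderiv ℝ ψ y v)
      + fderiv ℝ (fderiv ℝ ψ) y u v = fderiv ℝ ψ y (Γ y u v)) (u v w : V) :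
    curvature Γ' (ψ x) (fderiv ℝ ψ x u) (fderiv ℝ ψ x v) (fderiv ℝ ψ x w) =
      fderiv ℝ ψ x (curvature Γ x u v w) := by
  have hψd : HasFDerivAt ψ (fderiv ℝ ψ x) x := (hψ.differentiableAt (by simp)).hasFDerivAt
  have hc2 : ContDiffAt ℝ 2 (fderiv ℝ ψ) x := hψ.fderiv_right (by norm_num)
  have hψ2 : HasFDerivAt (fderiv ℝ ψ) (fderiv ℝ (fderiv ℝ ψ) x) x :=
    (hc2.differentiableAt two_ne_zero).hasFDerivAt
  have hψ3 : HasFDerivAt (fderiv ℝ (fderiv ℝ ψ)) (fderiv ℝ (fderiv ℝ (fderiv ℝ ψ)) x) x :=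
    ((hc2.fderiv_right (m := 1) (by norm_num)).differentiableAt one_ne_zero).hasFDerivAt
  have hsym3 : ∀ a b, fderiv ℝ (fderiv ℝ (fderiv ℝ ψ)) x a b =
      fderiv ℝ (fderiv ℝ (fderiv ℝ ψ)) x b a := (hc2.isSymmSndFDerivAt (by simp)).eq
  have hsym : ∀ a b, fderiv ℝ (fderiv ℝ ψ) x a b = fderiv ℝ (fderiv ℝ ψ) x b a :=
    ((hψ.of_le (by norm_num)).isSymmSndFDerivAt (n := 2) (by simp)).eq
  have key : ∀ a b c, fderiv ℝ Γ' (ψ x) (fderiv ℝ ψ x a) (fderiv ℝ ψ x b) (fderiv ℝ ψ x c)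
      + Γ' (ψ x) (fderiv ℝ (fderiv ℝ ψ) x a b) (fderiv ℝ ψ x c)
      + Γ' (ψ x) (fderiv ℝ ψ x b) (fderiv ℝ (fderiv ℝ ψ) x a c)
      + fderiv ℝ (fderiv ℝ (fderiv ℝ ψ)) x a b c =
      fderiv ℝ (fderiv ℝ ψ) x a (Γ x b c) + fderiv ℝ ψ x (fderiv ℝ Γ x a b c) := by
    intro a b c
    have h1 := hψ2.clm_apply ((hΓ.hasFDerivAt.clm_apply (hasFDerivAt_const b x)).clm_apply
      (hasFDerivAt_const c x))
    have h2 := (((hΓ'.hasFDerivAt.comp x hψd).clm_apply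
      (hψ2.clm_apply (hasFDerivAt_const b x))).clm_apply
        (hψ2.clm_apply (hasFDerivAt_const c x))).add
      ((hψ3.clm_apply (hasFDerivAt_const b x)).clm_apply (hasFDerivAt_const c x))
    have := (h1.congr_of_eventuallyEq (h.mono fun y hy ↦ hy b c)).unique h2
    have := congr($this a)
    simp at this
    rw [add_comm (fderiv ℝ (fderiv ℝ ψ) x a (Γ x b c)), this]
    abel
  have k1 := key u v w
  have k2 := key v u w
  have hx := h.self_of_nhds
  rw [curvature_apply, curvature_apply]
  simp only [map_add, map_sub]
  rw [← hx u (Γ x v w), ← hx v (Γ x u w), ← hx v w, ← hx u w]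
  simp only [map_add]
  rw [hsym3 v u, hsym v u] at k2
  linear_combination (norm := module) k1 - k2

end Connection

/-! ### Local flat coordinates on a normed space -/

section FlatCoordinates

variable {V : Type*} [NormedAddCommGroup V] [NormedSpace ℝ V]

/-- A `C²` map whose second derivative is `Dψ ∘ Γ`, where `Γ` is of class `C^m`, is of class
`C^{m+2}`. -/
lemma contDiffOn_of_fderiv_fderiv_eq {Γ : V → V →L[ℝ] V →L[ℝ] V} {Ω : Set V} (hΩ : IsOpen Ω)
    {m : ℕ} (hΓ : ContDiffOn ℝ m Γ Ω) {ψ : V → V} (hψ : DifferentiableOn ℝ ψ Ω)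
    (h : ∀ y ∈ Ω, HasFDerivAt (fderiv ℝ ψ) ((coframeCoeff Γ y).flip (fderiv ℝ ψ y)) y) :
    ContDiffOn ℝ (m + 2 : ℕ) ψ Ω := by
  have h1 := contDiffOn_of_fderiv_eq_flip hΩ (contDiffOn_coframeCoeff hΓ) h
  have h2 : ((m + 2 : ℕ) : ℕ∞ω) = (m + 1 : ℕ) + 1 := by norm_cast
  rw [h2, contDiffOn_succ_iff_fderiv_of_isOpen hΩ]
  exact ⟨hψ, by simp, h1⟩

/-- The derivation `β ↦ β(T ·, ·) + β(·, T ·)` of bilinear forms, as a function of `T`. -/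
def formDerivation (V : Type*) [NormedAddCommGroup V] [NormedSpace ℝ V] :
    (V →L[ℝ] V) →L[ℝ] (V →L[ℝ] V →L[ℝ] ℝ) →L[ℝ] (V →L[ℝ] V →L[ℝ] ℝ) :=
  (ContinuousLinearMap.compL ℝ V V (V →L[ℝ] ℝ)).flip +
    ContinuousLinearMap.compL ℝ _ _ _ (flipCLM V V ℝ) ∘L
      (ContinuousLinearMap.compL ℝ _ _ _).flip (flipCLM V V ℝ) ∘L
        (ContinuousLinearMap.compL ℝ V V (V →L[ℝ] ℝ)).flip

@[simp] lemma formDerivation_apply (T : V →L[ℝ] V) (β : V →L[ℝ] V →L[ℝ] ℝ) (v w : V) :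
    formDerivation V T β v w = β (T v) w + β v (T w) := by
  simp [formDerivation]

/-- A solution `A` of the coframe equation of a metric connection that is an isometry at the centre
of a ball is an isometry on the ball: the difference of the two bilinear forms solves a homogeneous
linear equation. -/
lemma isometry_of_isometry_center {Γ : V → V →L[ℝ] V →L[ℝ] V} {G : V → V →L[ℝ] V →L[ℝ] ℝ}
    {x₀ : V} {r : ℝ} (hΓ : ContinuousOn Γ (ball x₀ r))
    (hG : ∀ y ∈ ball x₀ r, DifferentiableAt ℝ G y)
    (hc : ∀ y ∈ ball x₀ r, ∀ u v w, fderiv ℝ G y u v w = G y (Γ y u v) w + G y v (Γ y u w))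
    {A : V → V →L[ℝ] V}
    (hA : ∀ y ∈ ball x₀ r, HasFDerivAt A ((coframeCoeff Γ y).flip (A y)) y)
    (η : V →L[ℝ] V →L[ℝ] ℝ) (h0 : ∀ v w, η (A x₀ v) (A x₀ w) = G x₀ v w) :
    ∀ y ∈ ball x₀ r, ∀ v w, η (A y v) (A y w) = G y v w := by
  set β : V → V →L[ℝ] V →L[ℝ] ℝ := fun y ↦ flipCLM V V ℝ (η ∘L A y) ∘L A y - flipCLM V V ℝ (G y)
    with hβ
  have hβv : ∀ y v w, β y w v = η (A y v) (A y w) - G y v w := fun y v w ↦ by simp [hβ]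
  suffices h : ∀ y ∈ ball x₀ r, β y = 0 by
    intro y hy v w
    rw [← sub_eq_zero, ← hβv, h y hy]; rfl
  refine eqOn_zero_of_hasFDerivAt (L := fun y ↦ formDerivation V ∘L Γ y)
    (continuousOn_const.clm_comp hΓ) (fun y hy ↦ ?_) (by ext w v; simp [hβv, h0])
  have h1 : HasFDerivAt (fun y ↦ η ∘L A y) _ y := (hasFDerivAt_const η y).clm_comp (hA y hy)
  have h2 : HasFDerivAt (fun y ↦ flipCLM V V ℝ (η ∘L A y)) _ y :=
    (flipCLM V V ℝ).hasFDerivAt.comp y h1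
  have h3 : HasFDerivAt (fun y ↦ flipCLM V V ℝ (G y)) _ y :=
    (flipCLM V V ℝ).hasFDerivAt.comp y (hG y hy).hasFDerivAt
  refine ((h2.clm_comp (hA y hy)).sub h3).congr_fderiv ?_
  ext u w v
  have := hc y hy u v w
  simp [hβv, this]
  ring

/-- Local flat coordinates of a metric whose Levi-Civita connection has vanishing curvature. -/
theorem exists_local_isometry [CompleteSpace V] {Γ : V → V →L[ℝ] V →L[ℝ] V}
    {G : V → V →L[ℝ] V →L[ℝ] ℝ} {Ω : Set V} (hΩ : IsOpen Ω) {m : ℕ} (hm : 1 ≤ m)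
    (hΓ : ContDiffOn ℝ m Γ Ω) (hG : ∀ y ∈ Ω, DifferentiableAt ℝ G y)
    (hsymm : ∀ y ∈ Ω, ∀ u v, Γ y u v = Γ y v u)
    (hc : ∀ y ∈ Ω, ∀ u v w, fderiv ℝ G y u v w = G y (Γ y u v) w + G y v (Γ y u w))
    (hR : ∀ y ∈ Ω, curvature Γ y = 0) (η : V →L[ℝ] V →L[ℝ] ℝ) {x₀ : V} (hx₀ : x₀ ∈ Ω)
    {A₀ : V →L[ℝ] V} (h0 : ∀ v w, η (A₀ v) (A₀ w) = G x₀ v w) :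
    ∃ r > 0, ball x₀ r ⊆ Ω ∧ ∃ ψ : V → V, ContDiffOn ℝ (m + 2 : ℕ) ψ (ball x₀ r) ∧
      ∀ y ∈ ball x₀ r, ∀ v w, η (fderiv ℝ ψ y v) (fderiv ℝ ψ y w) = G y v w := by
  have hm' : ((1 : ℕ) : ℕ∞ω) ≤ m := Nat.cast_le.2 hm
  have hΓ1 : ContDiffOn ℝ 1 Γ Ω := hΓ.of_le (by exact_mod_cast hm')
  obtain ⟨r, hr, hsub, A, hA0, hA⟩ := exists_hasFDerivAt_of_integrable hΩ
    (contDiffOn_coframeCoeff hΓ1) (fun y hy ↦ isIntegrableAt_coframeCoeff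
      ((hΓ1.contDiffAt (hΩ.mem_nhds hy)).differentiableAt one_ne_zero) (hR y hy)) hx₀ A₀
  obtain ⟨ψ, hψ⟩ := (convex_ball x₀ r).exists_forall_hasFDerivAt_of_fderiv_symmetric isOpen_ball
    (fun y hy ↦ (hA y hy).differentiableAt.differentiableWithinAt) (fun y hy u v ↦ by
      rw [(hA y hy).fderiv]
      simp [hsymm y (hsub hy) u v])
  have hfd : ∀ y ∈ ball x₀ r, fderiv ℝ ψ y = A y := fun y hy ↦ (hψ y hy).fderiv
  refine ⟨r, hr, hsub, ψ, contDiffOn_of_fderiv_fderiv_eq isOpen_ball (hΓ.mono hsub)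
    (fun y hy ↦ (hψ y hy).differentiableAt.differentiableWithinAt) (fun y hy ↦ ?_), ?_⟩
  · rw [hfd y hy]
    exact (hA y hy).congr_of_eventuallyEq
      (Filter.eventuallyEq_of_mem (isOpen_ball.mem_nhds hy) hfd)
  · intro y hy v w
    rw [hfd y hy]
    exact isometry_of_isometry_center (hΓ1.continuousOn.mono hsub) (fun y hy ↦ hG y (hsub hy))
      (fun y hy ↦ hc y (hsub hy)) hA η (by rwa [hA0]) y hy v w

end FlatCoordinates

/-! ### Charts and vector fields -/

section Charts

variable {n : ℕ} {M : Type*} [TopologicalSpace M] [ChartedSpace (EuclideanSpace ℝ (Fin n)) M]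

/-- A homeomorphism between open subsets of `M` and of `ℝⁿ` that is of class `C^r` in both
directions. -/
structure IsDiffeoChart (r : ℕ∞ω) (e : OpenPartialHomeomorph M (EuclideanSpace ℝ (Fin n))) :
    Prop where
  contMDiffOn : ContMDiffOn (𝓡 n) (𝓡 n) r e e.source
  contMDiffOn_symm : ContMDiffOn (𝓡 n) (𝓡 n) r e.symm e.target

/-- The derivative of the map `e` at `x`, with the tangent space at `x` unfolded to `ℝⁿ`. -/
def chartDeriv (e : OpenPartialHomeomorph M (EuclideanSpace ℝ (Fin n))) (x : M) :
    EuclideanSpace ℝ (Fin n) →L[ℝ] EuclideanSpace ℝ (Fin n) :=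
  mfderiv (𝓡 n) (𝓡 n) e x

/-- The derivative of the inverse of `e` at `y`, with the tangent space at `e.symm y` unfolded to
`ℝⁿ`. -/
def chartSymmDeriv (e : OpenPartialHomeomorph M (EuclideanSpace ℝ (Fin n)))
    (y : EuclideanSpace ℝ (Fin n)) : EuclideanSpace ℝ (Fin n) →L[ℝ] EuclideanSpace ℝ (Fin n) :=
  mfderiv (𝓡 n) (𝓡 n) e.symm y

lemma isDiffeoChart_of_mem_smoothCharts [IsManifold (𝓡 n) ∞ M]
    {e : OpenPartialHomeomorph M (EuclideanSpace ℝ (Fin n))} (he : e ∈ smoothCharts n M) :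
    IsDiffeoChart ∞ e :=
  ⟨contMDiffOn_of_mem_maximalAtlas he, contMDiffOn_symm_of_mem_maximalAtlas he⟩

lemma IsDiffeoChart.of_le {r s : ℕ∞ω} {e : OpenPartialHomeomorph M (EuclideanSpace ℝ (Fin n))}
    (he : IsDiffeoChart r e) (h : s ≤ r) : IsDiffeoChart s e :=
  ⟨he.1.of_le h, he.2.of_le h⟩

section

variable {e e' : OpenPartialHomeomorph M (EuclideanSpace ℝ (Fin n))} {x : M}
  {y : EuclideanSpace ℝ (Fin n)}

lemma IsDiffeoChart.mdifferentiable {r : ℕ∞ω} (he : IsDiffeoChart r e) (hr : r ≠ 0) :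
    e.MDifferentiable (𝓡 n) (𝓡 n) :=
  ⟨he.1.mdifferentiableOn hr, he.2.mdifferentiableOn hr⟩

lemma chartDeriv_chartSymmDeriv (he : e.MDifferentiable (𝓡 n) (𝓡 n)) (hy : y ∈ e.target)
    (v : EuclideanSpace ℝ (Fin n)) : chartDeriv e (e.symm y) (chartSymmDeriv e y v) = v :=
  congr($(he.comp_symm_deriv hy) v)

lemma chartSymmDeriv_chartDeriv (he : e.MDifferentiable (𝓡 n) (𝓡 n)) (hx : x ∈ e.source)
    (v : EuclideanSpace ℝ (Fin n)) : chartSymmDeriv e (e x) (chartDeriv e x v) = v :=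
  congr($(he.symm_comp_deriv hx) v)

/-- The chain rule for the transition map `e' ∘ e⁻¹`. -/
lemma hasFDerivAt_transition (he : e.MDifferentiable (𝓡 n) (𝓡 n))
    (he' : e'.MDifferentiable (𝓡 n) (𝓡 n)) (hy : y ∈ (e.symm.trans e').source) :
    HasFDerivAt (e' ∘ e.symm) (chartDeriv e' (e.symm y) ∘L chartSymmDeriv e y) y := by
  rw [OpenPartialHomeomorph.trans_source] at hy
  have h1 : HasMFDerivAt (𝓡 n) (𝓡 n) e.symm y (mfderiv (𝓡 n) (𝓡 n) e.symm y) :=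
    (he.mdifferentiableAt_symm hy.1).hasMFDerivAt
  have h2 : HasMFDerivAt (𝓡 n) (𝓡 n) e' (e.symm y) (mfderiv (𝓡 n) (𝓡 n) e' (e.symm y)) :=
    (he'.mdifferentiableAt hy.2).hasMFDerivAt
  exact (h2.comp y h1).hasFDerivAt

lemma contDiffOn_transition {r : ℕ∞ω} (he : IsDiffeoChart r e) (he' : IsDiffeoChart r e') :
    ContDiffOn ℝ r (e' ∘ e.symm) (e.symm.trans e').source := by
  rw [← contMDiffOn_iff_contDiffOn]
  refine he'.1.comp (he.2.mono fun y hy ↦ ?_) fun y hy ↦ ?_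
  · rw [OpenPartialHomeomorph.trans_source] at hy; exact hy.1
  · rw [OpenPartialHomeomorph.trans_source] at hy; exact hy.2

lemma injective_fderiv_transition (he : e.MDifferentiable (𝓡 n) (𝓡 n))
    (he' : e'.MDifferentiable (𝓡 n) (𝓡 n)) (hy : y ∈ (e.symm.trans e').source) :
    Function.Injective (fderiv ℝ (e' ∘ e.symm) y) := by
  rw [(hasFDerivAt_transition he he' hy).fderiv]
  rw [OpenPartialHomeomorph.trans_source] at hy
  refine Function.Injective.comp (g := chartDeriv e' (e.symm y)) ?_ ?_
  · exact he'.mfderiv_injective hy.2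
  · exact he.symm.mfderiv_injective hy.1

lemma surjective_fderiv_transition (he : e.MDifferentiable (𝓡 n) (𝓡 n))
    (he' : e'.MDifferentiable (𝓡 n) (𝓡 n)) (hy : y ∈ (e.symm.trans e').source) :
    Function.Surjective (fderiv ℝ (e' ∘ e.symm) y) :=
  LinearMap.surjective_of_injective (f := (fderiv ℝ (e' ∘ e.symm) y).toLinearMap)
    (injective_fderiv_transition he he' hy)

end

/-- The section `x ↦ (x, w)` of the tangent bundle only depends on `x` and on the vector `w` of the
model space. -/
lemma tangentBundle_mk_congr {x x' : M} (h : x' = x) (w : EuclideanSpace ℝ (Fin n)) :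
    (⟨x', w⟩ : TangentBundle (𝓡 n) M) = ⟨x, w⟩ := by
  subst h; rfl

variable [IsManifold (𝓡 n) ∞ M]

/-- The components of a `C^r` vector field in a smooth chart are of class `C^r`. -/
lemma contDiffOn_chartDeriv_field {r : ℕ∞ω} (hr : r + 1 ≤ ∞)
    {e : OpenPartialHomeomorph M (EuclideanSpace ℝ (Fin n))} (he : e ∈ smoothCharts n M)
    {X : (x : M) → TangentSpace (𝓡 n) x} {U : Set M}
    (hX : ContMDiffOn (𝓡 n) (𝓡 n).tangent r
      (fun x ↦ (⟨x, X x⟩ : TangentBundle (𝓡 n) M)) U) :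
    ContDiffOn ℝ r (fun y ↦ chartDeriv e (e.symm y) (X (e.symm y))) (e.target ∩ e.symm ⁻¹' U) := by
  have hr' : r ≤ ∞ := le_self_add.trans hr
  have hd := isDiffeoChart_of_mem_smoothCharts he
  have h1 : ContMDiffOn (𝓡 n) (𝓡 n).tangent r
      (fun y ↦ (⟨e.symm y, X (e.symm y)⟩ : TangentBundle (𝓡 n) M)) (e.target ∩ e.symm ⁻¹' U) :=
    hX.comp ((hd.2.of_le hr').mono inter_subset_left) fun y hy ↦ hy.2
  have h2 := hd.1.contMDiffOn_tangentMapWithin hr e.open_source.uniqueMDiffOn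
  have h3 := h2.comp h1 fun y hy ↦ e.map_target hy.1
  have h4 := (contMDiff_snd_tangentBundle_modelSpace (EuclideanSpace ℝ (Fin n)) (𝓡 n)
    (n := r)).comp_contMDiffOn h3
  rw [← contMDiffOn_iff_contDiffOn]
  refine h4.congr fun y hy ↦ ?_
  exact congr($(mfderivWithin_of_isOpen e.open_source (e.map_target hy.1)) (X (e.symm y))).symm

/-- A vector field whose components in the smooth chart `e` are of class `C^r` is of class `C^r`. -/
lemma contMDiffOn_of_contDiffOn_components {r : ℕ∞ω} (hr : r + 1 ≤ ∞)
    {e : OpenPartialHomeomorph M (EuclideanSpace ℝ (Fin n))} (he : e ∈ smoothCharts n M)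
    {X : (x : M) → TangentSpace (𝓡 n) x} {Ω : Set (EuclideanSpace ℝ (Fin n))} (hΩ : Ω ⊆ e.target)
    (hX : ContDiffOn ℝ r (fun y ↦ chartDeriv e (e.symm y) (X (e.symm y))) Ω) :
    ContMDiffOn (𝓡 n) (𝓡 n).tangent r
      (fun x ↦ (⟨x, X x⟩ : TangentBundle (𝓡 n) M)) (e.source ∩ e ⁻¹' Ω) := by
  have hr' : r ≤ ∞ := le_self_add.trans hr
  have hd := isDiffeoChart_of_mem_smoothCharts he
  have hX' := contMDiffOn_iff_contDiffOn.2 hX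
  have h1 : ContMDiffOn (𝓡 n) (𝓡 n).tangent r (fun y ↦
      (⟨y, chartDeriv e (e.symm y) (X (e.symm y))⟩ :
        TangentBundle (𝓡 n) (EuclideanSpace ℝ (Fin n)))) Ω := by
    intro y hy
    rw [Bundle.contMDiffWithinAt_totalSpace]
    exact ⟨contMDiffWithinAt_id, by simpa using hX' y hy⟩
  have h2 := hd.2.contMDiffOn_tangentMapWithin hr e.open_target.uniqueMDiffOn
  have h3 := h2.comp h1 fun y hy ↦ hΩ hy
  have h4 := h3.comp (t := Ω) ((hd.1.of_le hr').mono inter_subset_left) fun x hx ↦ hx.2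
  refine h4.congr fun x hx ↦ ?_
  have hXx : ∀ x' : M, x' = x → chartSymmDeriv e (e x) (chartDeriv e x' (X x')) = X x := by
    rintro _ rfl
    exact chartSymmDeriv_chartDeriv (hd.mdifferentiable (by simp)) hx.1 _
  have hw : (mfderivWithin (𝓡 n) (𝓡 n) e.symm e.target (e x)
      (chartDeriv e (e.symm (e x)) (X (e.symm (e x)))) : EuclideanSpace ℝ (Fin n)) = X x := by
    rw [mfderivWithin_of_isOpen e.open_target (e.map_source hx.1)]
    exact hXx _ (e.left_inv hx.1)
  refine (tangentBundle_mk_congr (e.left_inv hx.1).symm _).trans ?_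
  exact congrArg (fun w ↦ (⟨e.symm (e x), w⟩ : TangentBundle (𝓡 n) M)) hw.symm

/-- The vector field with constant components `v` in a smooth chart, along the inverse of the
chart. -/
lemma contMDiffOn_coordVec {e : OpenPartialHomeomorph M (EuclideanSpace ℝ (Fin n))}
    (he : e ∈ smoothCharts n M) (v : EuclideanSpace ℝ (Fin n)) :
    ContMDiffOn (𝓡 n) (𝓡 n).tangent ∞
      (fun y ↦ (⟨e.symm y, chartSymmDeriv e y v⟩ : TangentBundle (𝓡 n) M)) e.target := by
  have hd := isDiffeoChart_of_mem_smoothCharts he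
  have h1 : ContMDiff (𝓡 n) (𝓡 n).tangent ∞ (fun y ↦
      (⟨y, v⟩ : TangentBundle (𝓡 n) (EuclideanSpace ℝ (Fin n)))) := by
    intro y
    rw [Bundle.contMDiffAt_totalSpace]
    exact ⟨contMDiffAt_id, by simpa using contMDiffAt_const⟩
  have h2 := hd.2.contMDiffOn_tangentMapWithin (m := ∞) (by simp) e.open_target.uniqueMDiffOn
  refine (h2.comp h1.contMDiffOn fun y hy ↦ hy).congr fun y hy ↦ ?_
  simp only [Function.comp_apply, tangentMapWithin]
  rw [mfderivWithin_of_isOpen e.open_target hy]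
  rfl

end Charts

/-! ### The metric and its Christoffel symbols in charts -/

section EuclideanMaps

variable {n : ℕ}

lemma clm_ext_single {F : Type*} [NormedAddCommGroup F] [NormedSpace ℝ F]
    {f g : EuclideanSpace ℝ (Fin n) →L[ℝ] F}
    (h : ∀ i, f (EuclideanSpace.single i 1) = g (EuclideanSpace.single i 1)) : f = g := by
  have := (EuclideanSpace.basisFun (Fin n) ℝ).toBasis.ext (f₁ := f.toLinearMap)
    (f₂ := g.toLinearMap) (fun i ↦ by simpa using h i)
  ext1 x
  exact congr($this x)

lemma sum_smul_single (v : EuclideanSpace ℝ (Fin n)) :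
    ∑ i, v i • EuclideanSpace.single i (1 : ℝ) = v := by
  ext j
  simp [Finset.sum_apply, Pi.single_apply]

lemma contDiffOn_bilinear_of_single {m : ℕ∞ω} {Ω : Set (EuclideanSpace ℝ (Fin n))}
    {B : EuclideanSpace ℝ (Fin n) → EuclideanSpace ℝ (Fin n) →L[ℝ] EuclideanSpace ℝ (Fin n) →L[ℝ] ℝ}
    (h : ∀ i j, ContDiffOn ℝ m
      (fun y ↦ B y (EuclideanSpace.single i 1) (EuclideanSpace.single j 1)) Ω) :
    ContDiffOn ℝ m B Ω := by
  rw [contDiffOn_clm_apply]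
  intro v
  rw [contDiffOn_clm_apply]
  intro w
  have : (fun y ↦ B y v w) = fun y ↦ ∑ i, ∑ j, v i * (w j *
      B y (EuclideanSpace.single i 1) (EuclideanSpace.single j 1)) := by
    ext y
    conv_lhs => rw [← sum_smul_single v, ← sum_smul_single w]
    simp [Finset.mul_sum]
    rw [Finset.sum_comm]
    exact Finset.sum_congr rfl fun i _ ↦ Finset.sum_congr rfl fun j _ ↦ by ring
  rw [this]
  exact .sum fun i _ ↦ .sum fun j _ ↦ contDiffOn_const.mul (contDiffOn_const.mul (h i j))

lemma contDiffOn_det {E : Type*} [NormedAddCommGroup E] [NormedSpace ℝ E] {m : ℕ∞ω} {Ω : Set E}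
    {A : E → Matrix (Fin n) (Fin n) ℝ} (hA : ∀ i j, ContDiffOn ℝ m (fun y ↦ A y i j) Ω) :
    ContDiffOn ℝ m (fun y ↦ (A y).det) Ω := by
  simp only [Matrix.det_apply']
  exact .sum fun σ _ ↦ contDiffOn_const.mul (contDiffOn_prod fun i _ ↦ hA _ _)

/-- By Cramer's rule, the entries of the inverse matrix are as regular as those of the matrix. -/
lemma contDiffOn_matrix_inv {E : Type*} [NormedAddCommGroup E] [NormedSpace ℝ E] {m : ℕ∞ω}
    {Ω : Set E} {A : E → Matrix (Fin n) (Fin n) ℝ}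
    (hA : ∀ i j, ContDiffOn ℝ m (fun y ↦ A y i j) Ω) (hdet : ∀ y ∈ Ω, (A y).det ≠ 0)
    (i j : Fin n) : ContDiffOn ℝ m (fun y ↦ (A y)⁻¹ i j) Ω := by
  simp only [Matrix.inv_def, Ring.inverse_eq_inv', Matrix.smul_apply, smul_eq_mul,
    Matrix.adjugate_apply]
  refine ((contDiffOn_det hA).inv hdet).mul (contDiffOn_det fun a b ↦ ?_)
  by_cases h : a = j
  · subst h; simpa using contDiffOn_const
  · simpa [Matrix.updateRow_ne h] using hA a b

end EuclideanMaps

section MetricInCharts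

variable {n : ℕ} {M : Type*} [TopologicalSpace M] [ChartedSpace (EuclideanSpace ℝ (Fin n)) M]
  [IsManifold (𝓡 n) ∞ M] {m : ℕ∞ω} {p : ℕ}

namespace SemiRiemannianMetric

/-- The metric in the chart `e`, as a bilinear form on `ℝⁿ` depending on the coordinates `y`. -/
def chartForm (g : SemiRiemannianMetric m p n M)
    (e : OpenPartialHomeomorph M (EuclideanSpace ℝ (Fin n))) (y : EuclideanSpace ℝ (Fin n)) :
    EuclideanSpace ℝ (Fin n) →L[ℝ] EuclideanSpace ℝ (Fin n) →L[ℝ] ℝ :=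
  let B : EuclideanSpace ℝ (Fin n) →L[ℝ] EuclideanSpace ℝ (Fin n) →L[ℝ] ℝ := g.form (e.symm y)
  B.bilinearComp (chartSymmDeriv e y) (chartSymmDeriv e y)

/-- The Christoffel symbols in the chart `e`, as a bilinear map on `ℝⁿ` depending on the coordinates
`y`: `Γ(u, v)^a = Γ^a_{bc} u^b v^c`. -/
def chartChristoffel (g : SemiRiemannianMetric m p n M)
    (e : OpenPartialHomeomorph M (EuclideanSpace ℝ (Fin n))) (y : EuclideanSpace ℝ (Fin n)) :
    EuclideanSpace ℝ (Fin n) →L[ℝ] EuclideanSpace ℝ (Fin n) →L[ℝ] EuclideanSpace ℝ (Fin n) :=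
  ∑ a, ∑ b, ∑ c, g.christoffel e a b c y •
    (EuclideanSpace.proj b : EuclideanSpace ℝ (Fin n) →L[ℝ] ℝ).smulRight
      ((EuclideanSpace.proj c : EuclideanSpace ℝ (Fin n) →L[ℝ] ℝ).smulRight
        (EuclideanSpace.single a (1 : ℝ)))

variable (g : SemiRiemannianMetric m p n M)
  {e : OpenPartialHomeomorph M (EuclideanSpace ℝ (Fin n))} {y : EuclideanSpace ℝ (Fin n)}

lemma chartForm_single (i j : Fin n) :
    g.chartForm e y (EuclideanSpace.single i 1) (EuclideanSpace.single j 1) =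
      g.coordMatrix e y i j := rfl

lemma chartForm_symm (v w : EuclideanSpace ℝ (Fin n)) :
    g.chartForm e y v w = g.chartForm e y w v :=
  g.symm _ _ _

lemma form_nondegenerate (x : M) (v : TangentSpace (𝓡 n) x) (h : ∀ w, g.form x v w = 0) :
    v = 0 := by
  obtain ⟨b, hb⟩ := g.signature x
  have key : ∀ i, g.form x v (b i) = b.repr v i * semiEuclideanSign p i := fun i ↦ by
    conv_lhs => rw [← b.sum_repr v]
    simp [hb, -Module.Basis.sum_repr]
  rw [← b.sum_repr v]
  refine Finset.sum_eq_zero fun i _ ↦ ?_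
  have h1 := h (b i)
  rw [key, mul_eq_zero] at h1
  have h2 : semiEuclideanSign p i ≠ 0 := by unfold semiEuclideanSign; split_ifs <;> norm_num
  rw [h1.resolve_right h2, zero_smul]

lemma chartForm_nondegenerate (he : e.MDifferentiable (𝓡 n) (𝓡 n)) (hy : y ∈ e.target)
    (v : EuclideanSpace ℝ (Fin n)) (h : ∀ w, g.chartForm e y v w = 0) : v = 0 := by
  have h1 : chartSymmDeriv e y v = 0 := g.form_nondegenerate (e.symm y) _ fun w ↦ by
    obtain ⟨w, rfl⟩ := he.symm.mfderiv_surjective hy w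
    exact h w
  rw [← chartDeriv_chartSymmDeriv he hy v, h1, map_zero]

lemma det_coordMatrix_ne_zero (he : e.MDifferentiable (𝓡 n) (𝓡 n)) (hy : y ∈ e.target) :
    (g.coordMatrix e y).det ≠ 0 := by
  intro h
  obtain ⟨v, hv, hv'⟩ := Matrix.exists_mulVec_eq_zero_iff.2 h
  refine hv ?_
  have h0 : ∀ i, g.chartForm e y (EuclideanSpace.single i 1) (WithLp.toLp 2 v) = 0 := fun i ↦ by
    rw [← sum_smul_single (WithLp.toLp 2 v)]
    simpa [chartForm_single, Matrix.mulVec, dotProduct, mul_comm] using congr_fun hv' i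
  have : WithLp.toLp 2 v = 0 := g.chartForm_nondegenerate he hy _ fun w ↦ by
    rw [chartForm_symm, ← sum_smul_single w]
    simp [h0]
  simpa using this

lemma contDiffOn_coordMatrix (hm : m ≤ ∞) (he : e ∈ smoothCharts n M) (i j : Fin n) :
    ContDiffOn ℝ m (fun y ↦ g.coordMatrix e y i j) e.target := by
  rw [← contMDiffOn_iff_contDiffOn]
  have hd := isDiffeoChart_of_mem_smoothCharts he
  have hv := fun i ↦ (contMDiffOn_coordVec he (EuclideanSpace.single i (1 : ℝ))).of_le hm
  have h1 := g.contMDiff.comp_contMDiffOn (hd.2.of_le hm)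
  have h2 : ContMDiffOn (𝓡 n) ((𝓡 n).prod 𝓘(ℝ)) m (fun y ↦ Bundle.TotalSpace.mk' ℝ
      (E := Bundle.Trivial M ℝ) (e.symm y) (g.coordMatrix e y i j)) e.target := by
    apply ContMDiffOn.clm_bundle_apply₂ (F₁ := EuclideanSpace ℝ (Fin n))
      (F₂ := EuclideanSpace ℝ (Fin n))
    · exact h1
    · exact hv i
    · exact hv j
  intro y hy
  have := h2 y hy
  rw [Bundle.contMDiffWithinAt_totalSpace] at this
  exact this.2

lemma contDiffOn_chartForm (hm : m ≤ ∞) (he : e ∈ smoothCharts n M) :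
    ContDiffOn ℝ m (g.chartForm e) e.target :=
  contDiffOn_bilinear_of_single fun i j ↦ g.contDiffOn_coordMatrix hm he i j

lemma partialD_coordMatrix (hG : DifferentiableAt ℝ (g.chartForm e) y) (c i j : Fin n) :
    partialD c (fun z ↦ g.coordMatrix e z i j) y =
      fderiv ℝ (g.chartForm e) y (EuclideanSpace.single c 1) (EuclideanSpace.single i 1)
        (EuclideanSpace.single j 1) := by
  have h := (hG.hasFDerivAt.clm_apply (hasFDerivAt_const (EuclideanSpace.single i (1 : ℝ)) y)
    ).clm_apply (hasFDerivAt_const (EuclideanSpace.single j (1 : ℝ)) y)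
  have h' : (fun z ↦ g.coordMatrix e z i j) = fun z ↦ g.chartForm e z
    (EuclideanSpace.single i (1 : ℝ)) (EuclideanSpace.single j (1 : ℝ)) := rfl
  rw [partialD, h', h.fderiv]
  simp

lemma chartChristoffel_single (b c a : Fin n) :
    g.chartChristoffel e y (EuclideanSpace.single b 1) (EuclideanSpace.single c 1) a =
      g.christoffel e a b c y := by
  simp [chartChristoffel, Finset.sum_apply, Pi.single_apply]

lemma chartChristoffel_apply (v w : EuclideanSpace ℝ (Fin n)) (a : Fin n) :
    g.chartChristoffel e y v w a = ∑ b, ∑ c, g.christoffel e a b c y * (v b * w c) := by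
  simp [chartChristoffel, Finset.sum_apply, Pi.single_apply]

lemma contDiffOn_christoffel {k : ℕ} (g : SemiRiemannianMetric ((k + 1 : ℕ) : ℕ∞ω) p n M)
    (he : e ∈ smoothCharts n M) (a b c : Fin n) :
    ContDiffOn ℝ k (g.christoffel e a b c) e.target := by
  have hG : ∀ i j, ContDiffOn ℝ (k + 1 : ℕ) (fun y ↦ g.coordMatrix e y i j) e.target :=
    g.contDiffOn_coordMatrix (by exact_mod_cast le_top) he
  have hD : ∀ l i j, ContDiffOn ℝ k (partialD l fun y ↦ g.coordMatrix e y i j) e.target :=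
    fun l i j ↦ ((hG i j).fderiv_of_isOpen e.open_target (by norm_cast)).clm_apply contDiffOn_const
  have hI : ∀ i j, ContDiffOn ℝ k (fun y ↦ (g.coordMatrix e y)⁻¹ i j) e.target :=
    contDiffOn_matrix_inv (fun i j ↦ (hG i j).of_le (by exact_mod_cast Nat.le_succ k))
      fun y hy ↦ g.det_coordMatrix_ne_zero
        ((isDiffeoChart_of_mem_smoothCharts he).mdifferentiable (by simp)) hy
  exact contDiffOn_const.mul (.sum fun l _ ↦ (hI a l).mul
    (((hD c l b).add (hD b c l)).sub (hD l b c)))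

lemma contDiffOn_chartChristoffel {k : ℕ} (g : SemiRiemannianMetric ((k + 1 : ℕ) : ℕ∞ω) p n M)
    (he : e ∈ smoothCharts n M) : ContDiffOn ℝ k (g.chartChristoffel e) e.target :=
  .sum fun a _ ↦ .sum fun b _ ↦ .sum fun c _ ↦
    (g.contDiffOn_christoffel he a b c).smul contDiffOn_const

/-- The Christoffel symbols satisfy the Koszul formula. -/
lemma satisfiesKoszul (he : e.MDifferentiable (𝓡 n) (𝓡 n)) (hy : y ∈ e.target)
    (hG : DifferentiableAt ℝ (g.chartForm e) y) :
    SatisfiesKoszul (g.chartForm e) (g.chartChristoffel e) y := by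
  set D := fderiv ℝ (g.chartForm e) y with hD
  let E := EuclideanSpace ℝ (Fin n)
  have h : (2 : ℝ) • ((ContinuousLinearMap.compL ℝ E E (E →L[ℝ] ℝ) (g.chartForm e y)) ∘L
      g.chartChristoffel e y) = D + flipCLM _ _ _ D -
        flipCLM E E ℝ ∘L flipCLM E E (E →L[ℝ] ℝ) D := by
    refine clm_ext_single fun b ↦ clm_ext_single fun c ↦ clm_ext_single fun d ↦ ?_
    have hinv : (g.coordMatrix e y) * (g.coordMatrix e y)⁻¹ = 1 :=
      Matrix.mul_nonsing_inv _ (g.det_coordMatrix_ne_zero he hy).isUnit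
    have h1 : g.chartForm e y (g.chartChristoffel e y (EuclideanSpace.single b 1)
        (EuclideanSpace.single c 1)) (EuclideanSpace.single d 1) =
        ∑ a, g.coordMatrix e y d a * g.christoffel e a b c y := by
      rw [chartForm_symm, ← sum_smul_single (g.chartChristoffel e y _ _)]
      simp only [map_sum, map_smul, chartForm_single, chartChristoffel_single, smul_eq_mul]
      exact Finset.sum_congr rfl fun a _ ↦ mul_comm _ _
    have h2 : ∑ a, g.coordMatrix e y d a * g.christoffel e a b c y =
        1 / 2 * ∑ l, (g.coordMatrix e y * (g.coordMatrix e y)⁻¹) d l *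
          (partialD c (fun z ↦ g.coordMatrix e z l b) y +
            partialD b (fun z ↦ g.coordMatrix e z c l) y -
            partialD l (fun z ↦ g.coordMatrix e z b c) y) := by
      simp only [christoffel, Matrix.mul_apply, Finset.mul_sum, Finset.sum_mul]
      rw [Finset.sum_comm]
      exact Finset.sum_congr rfl fun l _ ↦ Finset.sum_congr rfl fun a _ ↦ by ring
    rw [hinv] at h2
    simp only [Matrix.one_apply, ite_mul, one_mul, zero_mul, Finset.sum_ite_eq, Finset.mem_univ,
      if_true, g.partialD_coordMatrix hG] at h2
    have hs := fun u v w ↦ fderiv_apply_symm hG (.of_forall fun z ↦ g.chartForm_symm) u v w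
    simp [h1, h2, hD]
    rw [hs (EuclideanSpace.single c 1) (EuclideanSpace.single d 1)]
    ring
  intro u v w
  simpa using congr($h u v w)

end SemiRiemannianMetric

end MetricInCharts

/-! ### The Riemann tensor field -/

lemma natCast_le_infty (r : ℕ) : (r : ℕ∞ω) ≤ ∞ := WithTop.coe_le_coe.2 le_top

/-- The tensor `(X, Y, Z) ↦ B (R(AX, AY) AZ)`. -/
def conjTrilinear {V W : Type*} [NormedAddCommGroup V] [NormedSpace ℝ V] [NormedAddCommGroup W]
    [NormedSpace ℝ W] (A : W →L[ℝ] V) (B : V →L[ℝ] W) (R : V →L[ℝ] V →L[ℝ] V →L[ℝ] V) :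
    W →ₗ[ℝ] W →ₗ[ℝ] W →ₗ[ℝ] W :=
  LinearMap.mk₂ ℝ (fun X Y ↦ (B ∘L R (A X) (A Y) ∘L A).toLinearMap)
    (fun X X' Y ↦ by ext Z; simp) (fun c X Y ↦ by ext Z; simp)
    (fun X Y Y' ↦ by ext Z; simp) (fun c X Y ↦ by ext Z; simp)

section CurvatureInCharts

variable {n : ℕ} {M : Type*} [TopologicalSpace M] [ChartedSpace (EuclideanSpace ℝ (Fin n)) M]
  [IsManifold (𝓡 n) ∞ M] {p : ℕ}
  {e e' : OpenPartialHomeomorph M (EuclideanSpace ℝ (Fin n))} {y : EuclideanSpace ℝ (Fin n)}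

namespace SemiRiemannianMetric

lemma form_congr {m : ℕ∞ω} (g : SemiRiemannianMetric m p n M) {x x' : M} (h : x' = x)
    {v v' w w' : EuclideanSpace ℝ (Fin n)} (hv : v' = v) (hw : w' = w) :
    g.form x' v' w' = g.form x v w := by
  subst h hv hw; rfl

/-- The metric in two charts. -/
lemma chartForm_transition {m : ℕ∞ω} (g : SemiRiemannianMetric m p n M)
    (he : e.MDifferentiable (𝓡 n) (𝓡 n)) (he' : e'.MDifferentiable (𝓡 n) (𝓡 n))
    (hy : y ∈ (e.symm.trans e').source) (v w : EuclideanSpace ℝ (Fin n)) :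
    g.chartForm e y v w = g.chartForm e' ((e' ∘ e.symm) y) (fderiv ℝ (e' ∘ e.symm) y v)
      (fderiv ℝ (e' ∘ e.symm) y w) := by
  rw [(hasFDerivAt_transition he he' hy).fderiv]
  rw [OpenPartialHomeomorph.trans_source] at hy
  exact (g.form_congr (e'.left_inv hy.2) (chartSymmDeriv_chartDeriv he' hy.2 _)
    (chartSymmDeriv_chartDeriv he' hy.2 _)).symm

variable {ν : ℕ} (g : SemiRiemannianMetric ((ν + 2 : ℕ) : ℕ∞ω) p n M)

lemma differentiableAt_chartForm (he : e ∈ smoothCharts n M) (hy : y ∈ e.target) :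
    DifferentiableAt ℝ (g.chartForm e) y :=
  ((g.contDiffOn_chartForm (natCast_le_infty _) he).contDiffAt
    (e.open_target.mem_nhds hy)).differentiableAt (by norm_cast)

lemma differentiableAt_chartChristoffel (he : e ∈ smoothCharts n M) (hy : y ∈ e.target) :
    DifferentiableAt ℝ (g.chartChristoffel e) y :=
  ((g.contDiffOn_chartChristoffel (k := ν + 1) he).contDiffAt
    (e.open_target.mem_nhds hy)).differentiableAt (by norm_cast)

lemma chartChristoffel_koszul (he : e ∈ smoothCharts n M) (hy : y ∈ e.target) :
    SatisfiesKoszul (g.chartForm e) (g.chartChristoffel e) y :=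
  g.satisfiesKoszul ((isDiffeoChart_of_mem_smoothCharts he).mdifferentiable (by simp)) hy
    (g.differentiableAt_chartForm he hy)

lemma chartChristoffel_symm (he : e ∈ smoothCharts n M) (hy : y ∈ e.target)
    (u v : EuclideanSpace ℝ (Fin n)) : g.chartChristoffel e y u v = g.chartChristoffel e y v u :=
  (g.chartChristoffel_koszul he hy).symm (g.differentiableAt_chartForm he hy)
    (.of_forall fun _ ↦ g.chartForm_symm) (g.chartForm_nondegenerate
      ((isDiffeoChart_of_mem_smoothCharts he).mdifferentiable (by simp)) hy) u v

lemma fderiv_chartForm (he : e ∈ smoothCharts n M) (hy : y ∈ e.target)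
    (u v w : EuclideanSpace ℝ (Fin n)) : fderiv ℝ (g.chartForm e) y u v w =
      g.chartForm e y (g.chartChristoffel e y u v) w
        + g.chartForm e y v (g.chartChristoffel e y u w) :=
  (g.chartChristoffel_koszul he hy).compatible (g.differentiableAt_chartForm he hy)
    (.of_forall fun _ ↦ g.chartForm_symm) u v w

/-- The transformation law of the Christoffel symbols. -/
lemma chartChristoffel_transition (he : e ∈ smoothCharts n M) (he' : e' ∈ smoothCharts n M)
    (hy : y ∈ (e.symm.trans e').source) (u v : EuclideanSpace ℝ (Fin n)) :
    g.chartChristoffel e' ((e' ∘ e.symm) y) (fderiv ℝ (e' ∘ e.symm) y u)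
        (fderiv ℝ (e' ∘ e.symm) y v) + fderiv ℝ (fderiv ℝ (e' ∘ e.symm)) y u v =
      fderiv ℝ (e' ∘ e.symm) y (g.chartChristoffel e y u v) := by
  have hd := isDiffeoChart_of_mem_smoothCharts he
  have hd' := isDiffeoChart_of_mem_smoothCharts he'
  have hm := hd.mdifferentiable (by simp)
  have hm' := hd'.mdifferentiable (by simp)
  have hy' := hy
  rw [OpenPartialHomeomorph.trans_source] at hy'
  have hψy : (e' ∘ e.symm) y ∈ e'.target := e'.map_source hy'.2
  have hψ : ContDiffAt ℝ 2 (e' ∘ e.symm) y := ((contDiffOn_transition hd hd').of_le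
    (natCast_le_infty 2)).contDiffAt ((e.symm.trans e').open_source.mem_nhds hy)
  exact (g.chartChristoffel_koszul he hy'.1).transform (g.chartChristoffel_koszul he' hψy) hψ
    (g.differentiableAt_chartForm he' hψy) (g.differentiableAt_chartForm he hy'.1)
    (fun _ _ ↦ g.chartForm_symm _ _) (g.chartForm_nondegenerate hm' hψy)
    (surjective_fderiv_transition hm hm' hy)
    (eventually_of_mem ((e.symm.trans e').open_source.mem_nhds hy) fun z hz ↦
      g.chartForm_transition hm hm' hz) u v

/-- The curvature tensors in two smooth charts correspond to each other. -/
lemma curvature_chartChristoffel_transition (he : e ∈ smoothCharts n M)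
    (he' : e' ∈ smoothCharts n M) (hy : y ∈ (e.symm.trans e').source)
    (u v w : EuclideanSpace ℝ (Fin n)) :
    curvature (g.chartChristoffel e') ((e' ∘ e.symm) y) (fderiv ℝ (e' ∘ e.symm) y u)
        (fderiv ℝ (e' ∘ e.symm) y v) (fderiv ℝ (e' ∘ e.symm) y w) =
      fderiv ℝ (e' ∘ e.symm) y (curvature (g.chartChristoffel e) y u v w) := by
  have hd := isDiffeoChart_of_mem_smoothCharts he
  have hd' := isDiffeoChart_of_mem_smoothCharts he'
  have hy' := hy
  rw [OpenPartialHomeomorph.trans_source] at hy'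
  have hψ : ContDiffAt ℝ 3 (e' ∘ e.symm) y := ((contDiffOn_transition hd hd').of_le
    (natCast_le_infty 3)).contDiffAt ((e.symm.trans e').open_source.mem_nhds hy)
  exact curvature_transform hψ (g.differentiableAt_chartChristoffel he hy'.1)
    (g.differentiableAt_chartChristoffel he' (e'.map_source hy'.2))
    (eventually_of_mem ((e.symm.trans e').open_source.mem_nhds hy) fun z hz ↦
      g.chartChristoffel_transition he he' hz) u v w

/-- The Riemann tensor field: at `x` it is the curvature of the Christoffel symbols in the preferred
chart at `x`. -/
def riemannTensor : TensorField13 n M := fun x ↦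
  let e := chartAt (EuclideanSpace ℝ (Fin n)) x
  conjTrilinear (chartDeriv e x) (chartSymmDeriv e (e x))
    (curvature (g.chartChristoffel e) (e x))

lemma riemannTensor_apply (x : M) (X Y Z : EuclideanSpace ℝ (Fin n)) :
    g.riemannTensor x X Y Z =
      chartSymmDeriv (chartAt (EuclideanSpace ℝ (Fin n)) x)
        (chartAt (EuclideanSpace ℝ (Fin n)) x x)
        (curvature (g.chartChristoffel (chartAt (EuclideanSpace ℝ (Fin n)) x))
          (chartAt (EuclideanSpace ℝ (Fin n)) x x)
          (chartDeriv (chartAt (EuclideanSpace ℝ (Fin n)) x) x X)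
          (chartDeriv (chartAt (EuclideanSpace ℝ (Fin n)) x) x Y)
          (chartDeriv (chartAt (EuclideanSpace ℝ (Fin n)) x) x Z)) := rfl

/-- In every smooth chart the Riemann tensor is the curvature of the Christoffel symbols. -/
lemma chartDeriv_riemannTensor (he : e ∈ smoothCharts n M) (hy : y ∈ e.target)
    (u v w : EuclideanSpace ℝ (Fin n)) :
    chartDeriv e (e.symm y) (g.riemannTensor (e.symm y) (chartSymmDeriv e y u)
      (chartSymmDeriv e y v) (chartSymmDeriv e y w)) =
      curvature (g.chartChristoffel e) y u v w := by
  set e' := chartAt (EuclideanSpace ℝ (Fin n)) (e.symm y) with he'def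
  have he' : e' ∈ smoothCharts n M := IsManifold.chart_mem_maximalAtlas _
  have hd := isDiffeoChart_of_mem_smoothCharts he
  have hd' := isDiffeoChart_of_mem_smoothCharts he'
  have hm := hd.mdifferentiable (by simp)
  have hm' := hd'.mdifferentiable (by simp)
  have hx : e.symm y ∈ e'.source := mem_chart_source _ _
  have hs : y ∈ (e.symm.trans e').source := by
    rw [OpenPartialHomeomorph.trans_source]; exact ⟨hy, hx⟩
  have h := g.curvature_chartChristoffel_transition he he' hs u v w
  rw [(hasFDerivAt_transition hm hm' hs).fderiv] at h
  rw [riemannTensor_apply, ← he'def]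
  refine (congrArg (fun z ↦ chartDeriv e (e.symm y) (chartSymmDeriv e' (e' (e.symm y)) z)) h).trans
    ?_
  rw [ContinuousLinearMap.comp_apply]
  have h2 := chartSymmDeriv_chartDeriv hm' hx
  rw [h2, chartDeriv_chartSymmDeriv hm hy]

lemma comp_riemannTensor (he : e ∈ smoothCharts n M) (hy : y ∈ e.target) (a b c d : Fin n) :
    g.riemannTensor.comp e a b c d y = curvature (g.chartChristoffel e) y
      (EuclideanSpace.single c 1) (EuclideanSpace.single d 1) (EuclideanSpace.single b 1) a := by
  rw [← g.chartDeriv_riemannTensor he hy]; rfl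

lemma isOfClass_riemannTensor : g.riemannTensor.IsOfClass ν := by
  intro e he a b c d
  have h1 := contDiffOn_curvature e.open_target (g.contDiffOn_chartChristoffel (k := ν + 1) he)
  have h2 : ContDiffOn ℝ ν (fun y ↦ curvature (g.chartChristoffel e) y
      (EuclideanSpace.single c 1) (EuclideanSpace.single d 1) (EuclideanSpace.single b 1)) e.target :=
    ((h1.clm_apply contDiffOn_const).clm_apply contDiffOn_const).clm_apply contDiffOn_const
  have h3 := (EuclideanSpace.proj a : EuclideanSpace ℝ (Fin n) →L[ℝ] ℝ).contDiff (n := ν)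
    |>.comp_contDiffOn h2
  exact h3.congr fun y hy ↦ g.comp_riemannTensor he hy a b c d

lemma riemannTensor_eq_zero_iff :
    (∀ x X Y Z, g.riemannTensor x X Y Z = 0) ↔
      ∀ e ∈ smoothCharts n M, ∀ y ∈ e.target, curvature (g.chartChristoffel e) y = 0 := by
  refine ⟨fun h e he y hy ↦ ?_, fun h x X Y Z ↦ ?_⟩
  · ext1 u; ext1 v; ext1 w
    rw [← g.chartDeriv_riemannTensor he hy]
    exact (congrArg _ (h _ _ _ _)).trans (map_zero _)
  · refine (g.riemannTensor_apply x X Y Z).trans ?_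
    rw [h _ (IsManifold.chart_mem_maximalAtlas _) _ (mem_chart_target _ x)]
    simp only [zero_apply, map_zero]
    rfl

end SemiRiemannianMetric

end CurvatureInCharts

/-! ### The distributional curvature -/

section TestFunctions

variable {n : ℕ} {Ω : Set (EuclideanSpace ℝ (Fin n))} {f φ : EuclideanSpace ℝ (Fin n) → ℝ}

lemma integrable_mul_of_tsupport_subset (hf : ContinuousOn f Ω) (hφ : Continuous φ)
    (hc : HasCompactSupport φ) (hs : tsupport φ ⊆ Ω) : Integrable fun y ↦ f y * φ y := by
  have h1 : IntegrableOn (fun y ↦ f y * φ y) (tsupport φ) :=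
    ((hf.mono hs).mul hφ.continuousOn).integrableOn_compact hc
  refine (integrableOn_iff_integrable_of_support_subset fun y hy ↦ ?_).1 h1
  exact subset_tsupport φ (right_ne_zero_of_mul hy)

lemma integrable_mul_partialD (hf : ContinuousOn f Ω) (hφ : ContDiff ℝ 1 φ)
    (hc : HasCompactSupport φ) (hs : tsupport φ ⊆ Ω) (j : Fin n) :
    Integrable fun y ↦ f y * partialD j φ y := by
  have h0 : Continuous (partialD j φ) :=
    (hφ.continuous_fderiv one_ne_zero).clm_apply continuous_const
  exact integrable_mul_of_tsupport_subset hf h0 (hc.fderiv_apply ℝ _)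
    ((tsupport_fderiv_apply_subset ℝ _).trans hs)

lemma continuousOn_partialD (hΩ : IsOpen Ω) (hf : ContDiffOn ℝ 1 f Ω) (j : Fin n) :
    ContinuousOn (partialD j f) Ω :=
  (hf.continuousOn_fderiv_of_isOpen hΩ le_rfl).clm_apply continuousOn_const

/-- Integration by parts against a test function. -/
lemma integral_mul_partialD (hΩ : IsOpen Ω) (hf : ContDiffOn ℝ 1 f Ω) (hφ : ContDiff ℝ 1 φ)
    (hc : HasCompactSupport φ) (hs : tsupport φ ⊆ Ω) (j : Fin n) :
    ∫ y, f y * partialD j φ y = -∫ y, partialD j f y * φ y :=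
  integral_mul_fderiv_eq_neg_fderiv_mul_of_integrable
    (integrable_mul_of_tsupport_subset (continuousOn_partialD hΩ hf j) hφ.continuous hc hs)
    (integrable_mul_partialD hf.continuousOn hφ hc hs j)
    (integrable_mul_of_tsupport_subset hf.continuousOn hφ.continuous hc hs)
    (fun _ hy ↦ (hf.contDiffAt (hΩ.mem_nhds (hs hy))).differentiableAt one_ne_zero)
    (fun z _ ↦ hφ.differentiable one_ne_zero z)

/-- The fundamental lemma of the calculus of variations, for continuous functions. -/
lemma eqOn_zero_of_integral_eq_zero (hΩ : IsOpen Ω) (hf : ContinuousOn f Ω)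
    (h : ∀ φ : EuclideanSpace ℝ (Fin n) → ℝ, ContDiff ℝ 1 φ → HasCompactSupport φ →
      tsupport φ ⊆ Ω → ∫ y, f y * φ y = 0) : ∀ y ∈ Ω, f y = 0 := by
  have h1 : ∀ᵐ y, y ∈ Ω → f y = 0 := hΩ.ae_eq_zero_of_integral_contDiff_smul_eq_zero
    (hf.locallyIntegrableOn hΩ.measurableSet) fun φ hφ hc hs ↦ by
      simpa [mul_comm] using h φ (hφ.of_le (by exact_mod_cast le_top)) hc hs
  have h2 : f =ᵐ[volume.restrict Ω] fun _ ↦ 0 := (ae_restrict_iff' hΩ.measurableSet).2 h1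
  exact Measure.eqOn_open_of_ae_eq h2 hΩ hf continuousOn_const

end TestFunctions

section DistributionalCurvature

variable {n : ℕ} {M : Type*} [TopologicalSpace M] [ChartedSpace (EuclideanSpace ℝ (Fin n)) M]
  [IsManifold (𝓡 n) ∞ M] {p : ℕ}
  {e : OpenPartialHomeomorph M (EuclideanSpace ℝ (Fin n))} {y : EuclideanSpace ℝ (Fin n)}

namespace SemiRiemannianMetric

variable {ν : ℕ} (g : SemiRiemannianMetric ((ν + 2 : ℕ) : ℕ∞ω) p n M)

lemma fderiv_chartChristoffel_single (he : e ∈ smoothCharts n M) (hy : y ∈ e.target)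
    (a b c d : Fin n) : fderiv ℝ (g.chartChristoffel e) y (EuclideanSpace.single d 1)
      (EuclideanSpace.single b 1) (EuclideanSpace.single c 1) a =
      partialD d (g.christoffel e a b c) y := by
  have h := (((g.differentiableAt_chartChristoffel he hy).hasFDerivAt.clm_apply
    (hasFDerivAt_const (EuclideanSpace.single b (1 : ℝ)) y)).clm_apply
    (hasFDerivAt_const (EuclideanSpace.single c (1 : ℝ)) y))
  have h1 : HasFDerivAt (g.christoffel e a b c) _ y :=
    ((EuclideanSpace.proj a : EuclideanSpace ℝ (Fin n) →L[ℝ] ℝ).hasFDerivAt.comp y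
      h).congr_of_eventuallyEq (.of_forall fun z ↦ by
        simp [chartChristoffel_single])
  rw [partialD, h1.fderiv]
  simp

/-- The components of the curvature of the Christoffel symbols. -/
lemma curvature_chartChristoffel_single (he : e ∈ smoothCharts n M) (hy : y ∈ e.target)
    (a b c d : Fin n) : curvature (g.chartChristoffel e) y (EuclideanSpace.single c 1)
      (EuclideanSpace.single d 1) (EuclideanSpace.single b 1) a =
      partialD c (g.christoffel e a d b) y - partialD d (g.christoffel e a c b) y
        + ∑ s, (g.christoffel e a c s y * g.christoffel e s d b y
          - g.christoffel e a d s y * g.christoffel e s c b y) := by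
  have h : ∀ c d : Fin n, g.chartChristoffel e y (EuclideanSpace.single c 1)
      (g.chartChristoffel e y (EuclideanSpace.single d 1) (EuclideanSpace.single b 1)) a =
      ∑ s, g.christoffel e a c s y * g.christoffel e s d b y := by
    intro c d
    rw [← sum_smul_single (g.chartChristoffel e y (EuclideanSpace.single d 1) _)]
    simp only [map_sum, map_smul, WithLp.ofLp_sum, WithLp.ofLp_smul, Finset.sum_apply,
      Pi.smul_apply, chartChristoffel_single, smul_eq_mul]
    exact Finset.sum_congr rfl fun s _ ↦ mul_comm _ _
  rw [curvature_apply]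
  simp only [PiLp.add_apply, PiLp.sub_apply, h, g.fderiv_chartChristoffel_single he hy,
    Finset.sum_sub_distrib]

/-- The distributional Riemann tensor is given by the Riemann tensor field. -/
theorem riemannEq_riemannTensor : g.RiemannEq g.riemannTensor := by
  rintro e he a b c d φ ⟨hφ, hc, hs⟩
  have hΓ : ∀ i j k, ContDiffOn ℝ 1 (g.christoffel e i j k) e.target := fun i j k ↦
    (g.contDiffOn_christoffel (k := ν + 1) he i j k).of_le (by norm_cast; omega)
  have hΓc := fun i j k ↦ (hΓ i j k).continuousOn
  have hQ : ContinuousOn (fun y ↦ ∑ s, (g.christoffel e a c s y * g.christoffel e s d b y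
      - g.christoffel e a d s y * g.christoffel e s c b y)) e.target :=
    continuousOn_finsetSum _ fun s _ ↦ ((hΓc _ _ _).mul (hΓc _ _ _)).sub
      ((hΓc _ _ _).mul (hΓc _ _ _))
  have i1 := integrable_mul_partialD (hΓc a d b) hφ hc hs c
  have i2 := integrable_mul_partialD (hΓc a c b) hφ hc hs d
  have i3 := integrable_mul_of_tsupport_subset hQ hφ.continuous hc hs
  have i4 := integrable_mul_of_tsupport_subset (continuousOn_partialD e.open_target (hΓ a d b) c)
    hφ.continuous hc hs
  have i5 := integrable_mul_of_tsupport_subset (continuousOn_partialD e.open_target (hΓ a c b) d)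
    hφ.continuous hc hs
  have i1' : Integrable fun y ↦ -(g.christoffel e a d b y * partialD c φ y) := i1.neg
  have i12 : Integrable fun y ↦ -(g.christoffel e a d b y * partialD c φ y)
      + g.christoffel e a c b y * partialD d φ y := i1'.add i2
  have i5' : Integrable fun y ↦ -(partialD d (g.christoffel e a c b) y * φ y) := i5.neg
  have i45 : Integrable fun y ↦ partialD c (g.christoffel e a d b) y * φ y
      + -(partialD d (g.christoffel e a c b) y * φ y) := i4.add i5'
  have h1 : g.distRiemann e a b c d φ = (-∫ y, g.christoffel e a d b y * partialD c φ y)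
      + (∫ y, g.christoffel e a c b y * partialD d φ y)
      + ∫ y, (∑ s, (g.christoffel e a c s y * g.christoffel e s d b y
      - g.christoffel e a d s y * g.christoffel e s c b y)) * φ y := by
    rw [distRiemann, integral_add i12 i3, integral_add i1' i2, integral_neg]
  rw [h1, integral_mul_partialD e.open_target (hΓ a d b) hφ hc hs,
    integral_mul_partialD e.open_target (hΓ a c b) hφ hc hs, neg_neg, ← integral_neg,
    ← integral_add i4 i5', ← integral_add i45 i3]
  congr 1
  ext y
  by_cases hy : y ∈ e.target
  · rw [g.comp_riemannTensor he hy, g.curvature_chartChristoffel_single he hy]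
    ring
  · have : φ y = 0 := image_eq_zero_of_notMem_tsupport fun h ↦ hy (hs h)
    simp [this]

/-- The distributional curvature vanishes if and only if the curvature tensor field does. -/
theorem isCurvatureFlat_iff :
    g.IsCurvatureFlat ↔
      ∀ e ∈ smoothCharts n M, ∀ y ∈ e.target, curvature (g.chartChristoffel e) y = 0 := by
  refine ⟨fun h e he ↦ ?_, fun h e he a b c d φ hφ ↦ ?_⟩
  · have h1 : ∀ a b c d, ∀ y ∈ e.target, g.riemannTensor.comp e a b c d y = 0 := fun a b c d ↦
      eqOn_zero_of_integral_eq_zero e.open_target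
        (g.isOfClass_riemannTensor e he a b c d).continuousOn fun φ hφ hc hs ↦ by
          rw [← g.riemannEq_riemannTensor e he a b c d φ ⟨hφ, hc, hs⟩]
          exact h e he a b c d φ ⟨hφ, hc, hs⟩
    intro y hy
    refine clm_ext_single fun c ↦ clm_ext_single fun d ↦ clm_ext_single fun b ↦ ?_
    ext a
    rw [← g.comp_riemannTensor he hy, h1 a b c d y hy]
    rfl
  · rw [g.riemannEq_riemannTensor e he a b c d φ hφ]
    refine integral_eq_zero_of_ae (.of_forall fun y ↦ ?_)
    by_cases hy : y ∈ e.target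
    · simp [g.comp_riemannTensor he hy, h e he y hy]
    · have : φ y = 0 := image_eq_zero_of_notMem_tsupport fun h ↦ hy (hφ.2.2 h)
      simp [this]

end SemiRiemannianMetric

end DistributionalCurvature

/-! ### Regularity of flat coordinates -/

section SemiEuclidean

variable {n : ℕ}

/-- The semi-Euclidean metric of signature `(p, n - p)` on `ℝⁿ`. -/
def semiEuclideanForm (p n : ℕ) :
    EuclideanSpace ℝ (Fin n) →L[ℝ] EuclideanSpace ℝ (Fin n) →L[ℝ] ℝ :=
  ∑ i : Fin n, semiEuclideanSign p i •
    (EuclideanSpace.proj i : EuclideanSpace ℝ (Fin n) →L[ℝ] ℝ).smulRight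
      (EuclideanSpace.proj i : EuclideanSpace ℝ (Fin n) →L[ℝ] ℝ)

lemma semiEuclideanForm_apply (p : ℕ) (v w : EuclideanSpace ℝ (Fin n)) :
    semiEuclideanForm p n v w = ∑ i, semiEuclideanSign p i * v i * w i := by
  simp [semiEuclideanForm, mul_assoc]

lemma semiEuclideanSign_eq_or (p : ℕ) (i : Fin n) :
    semiEuclideanSign p i = 1 ∨ semiEuclideanSign p i = -1 := by
  unfold semiEuclideanSign
  split_ifs <;> simp

lemma semiEuclideanForm_single (p : ℕ) (i j : Fin n) :
    semiEuclideanForm p n (EuclideanSpace.single i 1) (EuclideanSpace.single j 1) =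
      if i = j then semiEuclideanSign p i else 0 := by
  by_cases h : i = j
  · subst h; simp [semiEuclideanForm_apply]
  · simp [semiEuclideanForm_apply, h, Ne.symm h]

lemma semiEuclideanForm_symm (p : ℕ) (v w : EuclideanSpace ℝ (Fin n)) :
    semiEuclideanForm p n v w = semiEuclideanForm p n w v := by
  simp only [semiEuclideanForm_apply]
  exact Finset.sum_congr rfl fun i _ ↦ by ring

lemma semiEuclideanForm_nondegenerate (p : ℕ) (v : EuclideanSpace ℝ (Fin n))
    (h : ∀ w, semiEuclideanForm p n v w = 0) : v = 0 := by
  ext i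
  have := h (EuclideanSpace.single i 1)
  rcases semiEuclideanSign_eq_or p i with hi | hi <;>
    simpa [semiEuclideanForm_apply, Pi.single_apply, hi] using this

/-- A linear map that vanishes on `n` pairwise orthogonal non-isotropic vectors of `ℝⁿ` is zero. -/
lemma eq_zero_of_orthogonal_family {F : Type*} [NormedAddCommGroup F] [NormedSpace ℝ F]
    (B : EuclideanSpace ℝ (Fin n) →L[ℝ] EuclideanSpace ℝ (Fin n) →L[ℝ] ℝ)
    {W : Fin n → EuclideanSpace ℝ (Fin n)} (h : ∀ i j, i ≠ j → B (W i) (W j) = 0)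
    (h' : ∀ i, B (W i) (W i) ≠ 0) {f : EuclideanSpace ℝ (Fin n) →L[ℝ] F}
    (hf : ∀ i, f (W i) = 0) : f = 0 := by
  have hli : LinearIndependent ℝ W := by
    rw [Fintype.linearIndependent_iff]
    intro c hc i
    have h1 : B (∑ j, c j • W j) (W i) = c i * B (W i) (W i) := by
      rw [map_sum, FunLike.coe_sum, Finset.sum_apply, Finset.sum_eq_single i]
      · simp
      · intro j _ hj; simp [h j i hj]
      · simp
    rw [hc, map_zero, zero_apply] at h1
    exact (mul_eq_zero.1 h1.symm).resolve_right (h' i)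
  let b := basisOfLinearIndependentOfCardEqFinrank' W hli (by simp)
  have : f.toLinearMap = 0 := b.ext fun i ↦ by simpa [b] using hf i
  ext1 v
  exact congr($this v)

end SemiEuclidean

section Flatness

variable {n : ℕ} {M : Type*} [TopologicalSpace M] [ChartedSpace (EuclideanSpace ℝ (Fin n)) M]
  {p : ℕ} {e φ : OpenPartialHomeomorph M (EuclideanSpace ℝ (Fin n))} {y : EuclideanSpace ℝ (Fin n)}

/-- By the inverse function theorem, the regularity of a local homeomorphism to `ℝⁿ` and of its
inverse can be checked in smooth charts, for the homeomorphism only. -/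
lemma isDiffeoChart_of_transition {r : ℕ} (hr : r ≠ 0)
    (h : ∀ x ∈ φ.source, ∃ e ∈ smoothCharts n M, x ∈ e.source ∧
      ContDiffAt ℝ r (φ ∘ e.symm) (e x) ∧ Function.Injective (fderiv ℝ (φ ∘ e.symm) (e x))) :
    IsDiffeoChart r φ := by
  have hr' : (r : ℕ∞ω) ≠ 0 := by exact_mod_cast hr
  refine ⟨fun x hx ↦ ContMDiffAt.contMDiffWithinAt ?_, fun z hz ↦ ContMDiffAt.contMDiffWithinAt ?_⟩
  · obtain ⟨e, he, hxe, hc, -⟩ := h x hx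
    have h1 : ContMDiffAt (𝓡 n) (𝓡 n) r e x :=
      (contMDiffAt_of_mem_maximalAtlas he hxe).of_le (natCast_le_infty r)
    refine (hc.contMDiffAt.comp x h1).congr_of_eventuallyEq ?_
    filter_upwards [e.open_source.mem_nhds hxe] with x' hx'
    simp [e.left_inv hx']
  · obtain ⟨e, he, hxe, hc, hinj⟩ := h (φ.symm z) (φ.map_target hz)
    set θ := e.symm.trans φ with hθ
    have hz' : z ∈ θ.target := by
      rw [hθ, OpenPartialHomeomorph.trans_target]; exact ⟨hz, hxe⟩
    let A : EuclideanSpace ℝ (Fin n) ≃L[ℝ] EuclideanSpace ℝ (Fin n) :=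
      (LinearEquiv.ofInjectiveEndo (fderiv ℝ (φ ∘ e.symm) (e (φ.symm z))).toLinearMap
        hinj).toContinuousLinearEquiv
    have hA : HasFDerivAt θ (A : EuclideanSpace ℝ (Fin n) →L[ℝ] EuclideanSpace ℝ (Fin n))
        (θ.symm z) := (hc.differentiableAt hr').hasFDerivAt.congr_fderiv (by ext; rfl)
    have h1 : ContDiffAt ℝ r θ.symm z := θ.contDiffAt_symm hz' hA hc
    have h2 : ContMDiffAt (𝓡 n) (𝓡 n) r e.symm (θ.symm z) :=
      (contMDiffAt_symm_of_mem_maximalAtlas he (e.map_source hxe)).of_le (natCast_le_infty r)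
    refine (h2.comp z h1.contMDiffAt).congr_of_eventuallyEq ?_
    filter_upwards [θ.open_target.mem_nhds hz'] with z' hz''
    rw [hθ, OpenPartialHomeomorph.trans_target] at hz''
    exact (e.left_inv hz''.2).symm

variable [IsManifold (𝓡 n) ∞ M]

namespace SemiRiemannianMetric

lemma IsFlatCoordinates.isDiffeoChart {m r : ℕ∞ω} {g : SemiRiemannianMetric m p n M}
    (hφ : g.IsFlatCoordinates r φ) : IsDiffeoChart r φ := ⟨hφ.1, hφ.2⟩

/-- The metric in a chart is the pull-back of the semi-Euclidean metric under the transition to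
flat coordinates. -/
lemma IsFlatCoordinates.chartForm_eq {m r : ℕ∞ω} {g : SemiRiemannianMetric m p n M}
    (hφ : g.IsFlatCoordinates r φ) (hr : r ≠ 0) (he : e.MDifferentiable (𝓡 n) (𝓡 n))
    (hy : y ∈ (e.symm.trans φ).source) (v w : EuclideanSpace ℝ (Fin n)) :
    g.chartForm e y v w = semiEuclideanForm p n (fderiv ℝ (φ ∘ e.symm) y v)
      (fderiv ℝ (φ ∘ e.symm) y w) := by
  rw [(hasFDerivAt_transition he (hφ.isDiffeoChart.mdifferentiable hr) hy).fderiv,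
    semiEuclideanForm_apply]
  rw [OpenPartialHomeomorph.trans_source] at hy
  exact (hφ.isometry _ hy.2 (chartSymmDeriv e y v) (chartSymmDeriv e y w)).symm

variable {ν : ℕ} {g : SemiRiemannianMetric ((ν + 2 : ℕ) : ℕ∞ω) p n M}

/-- The second derivative of flat coordinates `ψ` in a chart is `Dψ ∘ Γ`. -/
lemma IsFlatCoordinates.hasFDerivAt_fderiv (hφ : g.IsFlatCoordinates 2 φ)
    (he : e ∈ smoothCharts n M) (hy : y ∈ (e.symm.trans φ).source) :
    HasFDerivAt (fderiv ℝ (φ ∘ e.symm))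
      ((coframeCoeff (g.chartChristoffel e) y).flip (fderiv ℝ (φ ∘ e.symm) y)) y := by
  have hd := isDiffeoChart_of_mem_smoothCharts he
  have hm := hd.mdifferentiable (by simp)
  have hmφ := hφ.isDiffeoChart.mdifferentiable two_ne_zero
  have hy' := hy
  rw [OpenPartialHomeomorph.trans_source] at hy'
  have hψ : ContDiffAt ℝ 2 (φ ∘ e.symm) y :=
    (contDiffOn_transition (hd.of_le (natCast_le_infty 2)) hφ.isDiffeoChart).contDiffAt
      ((e.symm.trans φ).open_source.mem_nhds hy)
  have h := (g.chartChristoffel_koszul he hy'.1).transform (G' := fun _ ↦ semiEuclideanForm p n)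
    (Γ' := fun _ ↦ 0) (fun u v w ↦ by simp) hψ (differentiableAt_const _)
    (g.differentiableAt_chartForm he hy'.1) (semiEuclideanForm_symm p)
    (semiEuclideanForm_nondegenerate p) (surjective_fderiv_transition hm hmφ hy)
    (eventually_of_mem ((e.symm.trans φ).open_source.mem_nhds hy) fun z hz ↦
      hφ.chartForm_eq two_ne_zero hm hz)
  refine (((hψ.fderiv_right (m := 1) (by norm_num)).differentiableAt
    one_ne_zero).hasFDerivAt).congr_fderiv ?_
  ext1 u; ext1 v
  simpa using h u v

/-- Flat `C²` coordinates are as regular as the metric permits. -/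
theorem IsFlatCoordinates.improve (hφ : g.IsFlatCoordinates 2 φ) :
    g.IsFlatCoordinates ((ν + 3 : ℕ) : ℕ∞ω) φ := by
  have key : IsDiffeoChart ((ν + 3 : ℕ) : ℕ∞ω) φ := by
    refine isDiffeoChart_of_transition (by omega) fun x hx ↦ ?_
    set e := chartAt (EuclideanSpace ℝ (Fin n)) x
    have he : e ∈ smoothCharts n M := IsManifold.chart_mem_maximalAtlas _
    have hxe : x ∈ e.source := mem_chart_source _ x
    have hm := (isDiffeoChart_of_mem_smoothCharts he).mdifferentiable (by simp)
    have hmφ := hφ.isDiffeoChart.mdifferentiable two_ne_zero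
    have hy : e x ∈ (e.symm.trans φ).source := by
      rw [OpenPartialHomeomorph.trans_source]
      exact ⟨e.map_source hxe, by simpa [e.left_inv hxe] using hx⟩
    have hsub : (e.symm.trans φ).source ⊆ e.target := by
      rw [OpenPartialHomeomorph.trans_source]; exact inter_subset_left
    refine ⟨e, he, hxe, ?_, injective_fderiv_transition hm hmφ hy⟩
    exact (contDiffOn_of_fderiv_fderiv_eq (e.symm.trans φ).open_source
      ((g.contDiffOn_chartChristoffel (k := ν + 1) he).mono hsub)
      (fun z hz ↦ (hasFDerivAt_transition hm hmφ hz).differentiableAt.differentiableWithinAt)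
      fun z hz ↦ hφ.hasFDerivAt_fderiv he hz).contDiffAt
        ((e.symm.trans φ).open_source.mem_nhds hy)
  exact ⟨key.1, key.2, hφ.isometry⟩

lemma IsFlatCoordinates.of_le {m r s : ℕ∞ω} {g : SemiRiemannianMetric m p n M}
    (hφ : g.IsFlatCoordinates r φ) (h : s ≤ r) : g.IsFlatCoordinates s φ :=
  ⟨hφ.1.of_le h, hφ.2.of_le h, hφ.isometry⟩

/-! ### Parallel fields -/

/-- The components `W` of a parallel field in a smooth chart satisfy `DW = -Γ(·, W)`. -/
lemma hasFDerivAt_of_isParallelOn {X : (x : M) → TangentSpace (𝓡 n) x} {U : Set M}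
    (hX : g.IsParallelOn X U) (he : e ∈ smoothCharts n M) (hy : y ∈ e.target ∩ e.symm ⁻¹' U)
    (hd : DifferentiableAt ℝ (fun z ↦ chartDeriv e (e.symm z) (X (e.symm z))) y) :
    HasFDerivAt (fun z ↦ chartDeriv e (e.symm z) (X (e.symm z)))
      (-(g.chartChristoffel e y).flip (chartDeriv e (e.symm y) (X (e.symm y)))) y := by
  refine hd.hasFDerivAt.congr_fderiv (clm_ext_single fun j ↦ ?_)
  ext i
  have h1 := hX e he y hy i j
  have h2 : HasFDerivAt (fun z ↦ vecComp e i (X (e.symm z))) _ y :=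
    (EuclideanSpace.proj i : EuclideanSpace ℝ (Fin n) →L[ℝ] ℝ).hasFDerivAt.comp y hd.hasFDerivAt
  rw [partialD, h2.fderiv] at h1
  refine (eq_neg_of_add_eq_zero_left h1).trans ?_
  simp [chartChristoffel_apply]
  rfl

lemma isParallelOn_of_hasFDerivAt {X : (x : M) → TangentSpace (𝓡 n) x} {U : Set M}
    (h : ∀ e ∈ smoothCharts n M, ∀ y ∈ e.target ∩ e.symm ⁻¹' U,
      HasFDerivAt (fun z ↦ chartDeriv e (e.symm z) (X (e.symm z)))
        (-(g.chartChristoffel e y).flip (chartDeriv e (e.symm y) (X (e.symm y)))) y) :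
    g.IsParallelOn X U := by
  intro e he y hy i j
  have h2 : HasFDerivAt (fun z ↦ vecComp e i (X (e.symm z))) _ y :=
    (EuclideanSpace.proj i : EuclideanSpace ℝ (Fin n) →L[ℝ] ℝ).hasFDerivAt.comp y (h e he y hy)
  rw [partialD, h2.fderiv]
  simp [chartChristoffel_apply]
  exact neg_add_eq_zero.2 rfl

namespace IsParallelOrthonormalFrame

variable {E : Fin n → (x : M) → TangentSpace (𝓡 n) x} {U : Set M}

lemma hasFDerivAt_components (hE : g.IsParallelOrthonormalFrame 1 E U) (he : e ∈ smoothCharts n M)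
    (i : Fin n) (hy : y ∈ e.target ∩ e.symm ⁻¹' U) :
    HasFDerivAt (fun z ↦ chartDeriv e (e.symm z) (E i (e.symm z)))
      (-(g.chartChristoffel e y).flip (chartDeriv e (e.symm y) (E i (e.symm y)))) y :=
  hasFDerivAt_of_isParallelOn (hE.parallel i) he hy
    (((contDiffOn_chartDeriv_field (natCast_le_infty 2) he (hE.contMDiffOn i)).contDiffAt
      ((e.isOpen_inter_preimage_symm hE.isOpen).mem_nhds hy)).differentiableAt one_ne_zero)

/-- Parallel `C¹` frames are as regular as the metric. -/
theorem improve (hE : g.IsParallelOrthonormalFrame 1 E U) :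
    g.IsParallelOrthonormalFrame ((ν + 2 : ℕ) : ℕ∞ω) E U := by
  refine ⟨hE.isOpen, fun i x hx ↦ ContMDiffAt.contMDiffWithinAt ?_, hE.orthogonal, hE.unit,
    hE.parallel⟩
  set e := chartAt (EuclideanSpace ℝ (Fin n)) x
  have he : e ∈ smoothCharts n M := IsManifold.chart_mem_maximalAtlas _
  have hxe : x ∈ e.source := mem_chart_source _ x
  have hΩ := e.isOpen_inter_preimage_symm hE.isOpen
  have h1 : ContDiffOn ℝ (ν + 1 : ℕ) (fun y ↦ -g.chartChristoffel e y)
    (e.target ∩ e.symm ⁻¹' U) :=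
    (g.contDiffOn_chartChristoffel (k := ν + 1) he).neg.mono inter_subset_left
  have h2 := contDiffOn_of_fderiv_eq_flip hΩ h1 (f := fun z ↦ chartDeriv e (e.symm z)
    (E i (e.symm z))) fun y hy ↦ (hE.hasFDerivAt_components he i hy).congr_fderiv (by
      ext1 v; simp)
  have h3 := contMDiffOn_of_contDiffOn_components (natCast_le_infty (ν + 3)) he inter_subset_left h2
  refine h3.contMDiffAt ((e.isOpen_inter_preimage hΩ).mem_nhds ⟨hxe, e.map_source hxe, ?_⟩)
  simpa [e.left_inv hxe] using hx

/-- Parallel frames force the curvature to vanish. -/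
lemma curvature_eq_zero (hE : g.IsParallelOrthonormalFrame 1 E U) (he : e ∈ smoothCharts n M)
    (hy : y ∈ e.target ∩ e.symm ⁻¹' U) : curvature (g.chartChristoffel e) y = 0 := by
  have hm := (isDiffeoChart_of_mem_smoothCharts he).mdifferentiable (by simp)
  have hform : ∀ i j, g.chartForm e y (chartDeriv e (e.symm y) (E i (e.symm y)))
      (chartDeriv e (e.symm y) (E j (e.symm y))) =
      g.form (e.symm y) (E i (e.symm y)) (E j (e.symm y)) := by
    have h : ∀ v, chartSymmDeriv e y (chartDeriv e (e.symm y) v) = v := fun v ↦ by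
      have := chartSymmDeriv_chartDeriv hm (e.map_target hy.1) v
      rwa [e.right_inv hy.1] at this
    exact fun i j ↦ g.form_congr rfl (h _) (h _)
  ext1 u; ext1 v
  refine eq_zero_of_orthogonal_family (g.chartForm e y)
    (W := fun i ↦ chartDeriv e (e.symm y) (E i (e.symm y))) (fun i j hij ↦ ?_) (fun i ↦ ?_)
    fun i ↦ ?_
  · rw [hform, hE.orthogonal _ hy.2 i j hij]
  · rw [hform]
    rcases hE.unit _ hy.2 i with h | h <;> rw [h] <;> norm_num
  · exact curvature_apply_eq_zero_of_parallel (g.differentiableAt_chartChristoffel he hy.1)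
      (W := fun z ↦ chartDeriv e (e.symm z) (E i (e.symm z)))
      (eventually_of_mem ((e.isOpen_inter_preimage_symm hE.isOpen).mem_nhds hy)
        fun z hz ↦ hE.hasFDerivAt_components he i hz) u v

end IsParallelOrthonormalFrame

end SemiRiemannianMetric

end Flatness

/-! ### Existence of flat coordinates and of parallel frames -/

section Existence

variable {n : ℕ} {M : Type*} [TopologicalSpace M] [ChartedSpace (EuclideanSpace ℝ (Fin n)) M]
  {p : ℕ} {e φ : OpenPartialHomeomorph M (EuclideanSpace ℝ (Fin n))}
  {y : EuclideanSpace ℝ (Fin n)}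

/-- The coordinate fields `∂_i` of `φ`. -/
def coordinateFrame (φ : OpenPartialHomeomorph M (EuclideanSpace ℝ (Fin n))) (i : Fin n) (x : M) :
    TangentSpace (𝓡 n) x :=
  (chartSymmDeriv φ (φ x) (EuclideanSpace.single i 1) : EuclideanSpace ℝ (Fin n))

lemma chartDeriv_coordinateFrame (hφ : φ.MDifferentiable (𝓡 n) (𝓡 n)) {x : M} (hx : x ∈ φ.source)
    (i : Fin n) : chartDeriv φ x (coordinateFrame φ i x) = EuclideanSpace.single i 1 := by
  have := chartDeriv_chartSymmDeriv hφ (φ.map_source hx) (EuclideanSpace.single i 1)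
  rwa [φ.left_inv hx] at this

variable [IsManifold (𝓡 n) ∞ M]

namespace SemiRiemannianMetric

variable {ν : ℕ} {g : SemiRiemannianMetric ((ν + 2 : ℕ) : ℕ∞ω) p n M}

/-- The components, in a smooth chart, of the coordinate fields of flat coordinates: they are of
class `C^{ν+2}` and satisfy the equation of parallel fields. -/
lemma IsFlatCoordinates.coordinateFrame_components
    (hφ : g.IsFlatCoordinates ((ν + 3 : ℕ) : ℕ∞ω) φ) (he : e ∈ smoothCharts n M) (i : Fin n) :
    ContDiffOn ℝ (ν + 2 : ℕ) (fun z ↦ chartDeriv e (e.symm z) (coordinateFrame φ i (e.symm z)))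
      (e.symm.trans φ).source ∧ ∀ y ∈ (e.symm.trans φ).source,
      HasFDerivAt (fun z ↦ chartDeriv e (e.symm z) (coordinateFrame φ i (e.symm z)))
        (-(g.chartChristoffel e y).flip
          (chartDeriv e (e.symm y) (coordinateFrame φ i (e.symm y)))) y := by
  have hd := (isDiffeoChart_of_mem_smoothCharts he).of_le (natCast_le_infty (ν + 3))
  have hdφ := hφ.isDiffeoChart
  have hν : ((ν + 3 : ℕ) : ℕ∞ω) ≠ 0 := by exact_mod_cast (by omega : ν + 3 ≠ 0)
  have hm := hd.mdifferentiable hν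
  have hmφ := hdφ.mdifferentiable hν
  have hφ2 : g.IsFlatCoordinates 2 φ := hφ.of_le (by exact_mod_cast (by omega : 2 ≤ ν + 3))
  set Ω := (e.symm.trans φ).source with hΩdef
  have hΩ : IsOpen Ω := (e.symm.trans φ).open_source
  have hmem : ∀ z ∈ Ω, z ∈ e.target ∧ e.symm z ∈ φ.source := fun z hz ↦ by
    rwa [hΩdef, OpenPartialHomeomorph.trans_source] at hz
  set ψ := φ ∘ e.symm with hψ
  set W := fun z ↦ chartDeriv e (e.symm z) (coordinateFrame φ i (e.symm z)) with hW
  have hψΩ : MapsTo ψ Ω (φ.symm.trans e).source := fun z hz ↦ by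
    rw [OpenPartialHomeomorph.trans_source]
    refine ⟨φ.map_source (hmem z hz).2, ?_⟩
    simp only [hψ, Function.comp_apply, mem_preimage, φ.left_inv (hmem z hz).2]
    exact e.map_target (hmem z hz).1
  have hc : ContDiffOn ℝ (ν + 2 : ℕ) W Ω := by
    have h1 : ContDiffOn ℝ (ν + 2 : ℕ) (fderiv ℝ (e ∘ φ.symm)) (φ.symm.trans e).source :=
      (contDiffOn_transition hdφ hd).fderiv_of_isOpen (φ.symm.trans e).open_source (by norm_cast)
    have h2 : ContDiffOn ℝ (ν + 2 : ℕ) ψ Ω :=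
      (contDiffOn_transition hd hdφ).of_le (by exact_mod_cast Nat.le_succ _)
    refine ((h1.comp h2 hψΩ).clm_apply
      (contDiffOn_const (c := EuclideanSpace.single i (1 : ℝ)))).congr fun z hz ↦ ?_
    rw [Function.comp_apply, (hasFDerivAt_transition hmφ hm (hψΩ hz)).fderiv]
    simp only [hψ, Function.comp_apply, ContinuousLinearMap.comp_apply, φ.left_inv (hmem z hz).2]
    rfl
  refine ⟨hc, fun y hy ↦ ?_⟩
  -- differentiate the identity `Dψ(W) = e_i`
  have hψW : ∀ z ∈ Ω, fderiv ℝ ψ z (W z) = EuclideanSpace.single i 1 := fun z hz ↦ by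
    rw [(hasFDerivAt_transition hm hmφ hz).fderiv, ContinuousLinearMap.comp_apply]
    have h := chartSymmDeriv_chartDeriv hm (e.map_target (hmem z hz).1)
      (coordinateFrame φ i (e.symm z))
    rw [e.right_inv (hmem z hz).1] at h
    rw [hW]
    exact (congrArg _ h).trans (chartDeriv_coordinateFrame hmφ (hmem z hz).2 i)
  have hWd : HasFDerivAt W (fderiv ℝ W y) y :=
    ((hc.contDiffAt (hΩ.mem_nhds hy)).differentiableAt (by norm_cast)).hasFDerivAt
  have h1 := (hφ2.hasFDerivAt_fderiv he hy).clm_apply hWd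
  have h2 := h1.unique ((hasFDerivAt_const (EuclideanSpace.single i (1 : ℝ)) y
    ).congr_of_eventuallyEq (eventually_of_mem (hΩ.mem_nhds hy) hψW))
  refine hWd.congr_fderiv ?_
  ext1 u
  refine injective_fderiv_transition hm hmφ hy ?_
  have h3 := congr($h2 u)
  simp only [_root_.add_apply, ContinuousLinearMap.comp_apply, ContinuousLinearMap.flip_apply,
    coframeCoeff_apply, zero_apply] at h3
  rw [_root_.neg_apply, map_neg, ContinuousLinearMap.flip_apply]
  exact eq_neg_of_add_eq_zero_left h3

/-- The coordinate fields of flat coordinates form a parallel orthonormal frame. -/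
theorem IsFlatCoordinates.isParallelOrthonormalFrame
    (hφ : g.IsFlatCoordinates ((ν + 3 : ℕ) : ℕ∞ω) φ) :
    g.IsParallelOrthonormalFrame ((ν + 2 : ℕ) : ℕ∞ω) (coordinateFrame φ) φ.source := by
  have hν : ((ν + 3 : ℕ) : ℕ∞ω) ≠ 0 := by exact_mod_cast (by omega : ν + 3 ≠ 0)
  have hmφ := hφ.isDiffeoChart.mdifferentiable hν
  have hform : ∀ x ∈ φ.source, ∀ i j, g.form x (coordinateFrame φ i x) (coordinateFrame φ j x) =
      if i = j then semiEuclideanSign p i else 0 := by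
    intro x hx i j
    rw [← hφ.isometry x hx, ← semiEuclideanForm_single, semiEuclideanForm_apply,
      ← chartDeriv_coordinateFrame hmφ hx, ← chartDeriv_coordinateFrame hmφ hx]
    rfl
  refine ⟨φ.open_source, fun i x hx ↦ ContMDiffAt.contMDiffWithinAt ?_, fun x hx i j hij ↦ ?_,
    fun x hx i ↦ ?_, fun i ↦ isParallelOn_of_hasFDerivAt fun e he y hy ↦ ?_⟩
  · set e := chartAt (EuclideanSpace ℝ (Fin n)) x
    have he : e ∈ smoothCharts n M := IsManifold.chart_mem_maximalAtlas _
    have hxe : x ∈ e.source := mem_chart_source _ x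
    have hsub : (e.symm.trans φ).source ⊆ e.target := by
      rw [OpenPartialHomeomorph.trans_source]; exact inter_subset_left
    have hx' : e x ∈ (e.symm.trans φ).source := by
      rw [OpenPartialHomeomorph.trans_source]
      exact ⟨e.map_source hxe, by simpa [e.left_inv hxe] using hx⟩
    have h := contMDiffOn_of_contDiffOn_components (natCast_le_infty (ν + 3)) he hsub
      (hφ.coordinateFrame_components he i).1
    exact h.contMDiffAt
      ((e.isOpen_inter_preimage (e.symm.trans φ).open_source).mem_nhds ⟨hxe, hx'⟩)
  · rw [hform x hx, if_neg hij]
  · rw [hform x hx, if_pos rfl]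
    exact semiEuclideanSign_eq_or p i
  · refine (hφ.coordinateFrame_components he i).2 y ?_
    rw [OpenPartialHomeomorph.trans_source]
    exact hy

/-- A pseudo-orthonormal basis of the tangent space at `x`, as an isometry onto the semi-Euclidean
space. -/
lemma exists_isometry_tangentSpace {m : ℕ∞ω} (g : SemiRiemannianMetric m p n M) (x : M) :
    ∃ A : EuclideanSpace ℝ (Fin n) →L[ℝ] EuclideanSpace ℝ (Fin n),
      ∀ v w, semiEuclideanForm p n (A v) (A w) = g.form x v w := by
  obtain ⟨b, hb⟩ := g.signature x
  let A : TangentSpace (𝓡 n) x →ₗ[ℝ] EuclideanSpace ℝ (Fin n) :=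
    (WithLp.linearEquiv 2 ℝ (Fin n → ℝ)).symm.toLinearMap ∘ₗ b.equivFun.toLinearMap
  have hA : ∀ v i, A v i = b.repr v i := fun v i ↦ rfl
  let A' : EuclideanSpace ℝ (Fin n) →ₗ[ℝ] EuclideanSpace ℝ (Fin n) := A
  refine ⟨LinearMap.toContinuousLinearMap A', fun v w ↦ ?_⟩
  have key : ∀ v w : TangentSpace (𝓡 n) x,
      g.form x v w = ∑ i, semiEuclideanSign p i * A v i * A w i := by
    intro v w
    conv_lhs => rw [← b.sum_repr v, ← b.sum_repr w]
    simp only [map_sum, map_smul, FunLike.coe_sum, Finset.sum_apply, _root_.smul_apply, hb,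
      smul_eq_mul, mul_ite, mul_zero, hA]
    refine Finset.sum_congr rfl fun i _ ↦ ?_
    simp
    ring
  rw [semiEuclideanForm_apply]
  exact (key v w).symm

/-- Flat coordinates exist near every point if the curvature vanishes. -/
theorem isCoordinateFlat_of_curvature_eq_zero
    (h : ∀ e ∈ smoothCharts n M, ∀ y ∈ e.target, curvature (g.chartChristoffel e) y = 0) :
    g.IsCoordinateFlat ((ν + 3 : ℕ) : ℕ∞ω) := by
  intro x
  set e := chartAt (EuclideanSpace ℝ (Fin n)) x
  have he : e ∈ smoothCharts n M := IsManifold.chart_mem_maximalAtlas _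
  have hxe : x ∈ e.source := mem_chart_source _ x
  have hex : e x ∈ e.target := e.map_source hxe
  have hm := (isDiffeoChart_of_mem_smoothCharts he).mdifferentiable (by simp)
  obtain ⟨A, hA⟩ := g.exists_isometry_tangentSpace x
  have hform : ∀ x' ∈ e.source, ∀ v w : EuclideanSpace ℝ (Fin n),
      g.chartForm e (e x') (chartDeriv e x' v) (chartDeriv e x' w) = g.form x' v w :=
    fun x' hx' v w ↦ g.form_congr (e.left_inv hx') (chartSymmDeriv_chartDeriv hm hx' v)
      (chartSymmDeriv_chartDeriv hm hx' w)
  have h0 : ∀ v w, semiEuclideanForm p n ((A ∘L chartSymmDeriv e (e x)) v)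
      ((A ∘L chartSymmDeriv e (e x)) w) = g.chartForm e (e x) v w := fun v w ↦
    (hA _ _).trans (g.form_congr (e.left_inv hxe) rfl rfl).symm
  obtain ⟨r, hr, hsub, ψ, hψ, hiso⟩ := exists_local_isometry e.open_target (m := ν + 1) (by omega)
    (g.contDiffOn_chartChristoffel (k := ν + 1) he)
    (fun y hy ↦ g.differentiableAt_chartForm he hy) (fun y hy ↦ g.chartChristoffel_symm he hy)
    (fun y hy ↦ g.fderiv_chartForm he hy) (h e he) (semiEuclideanForm p n) hex h0
  have hν : ((ν + 3 : ℕ) : ℕ∞ω) ≠ 0 := by exact_mod_cast (by omega : ν + 3 ≠ 0)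
  have hψat : ∀ y ∈ ball (e x) r, ContDiffAt ℝ (ν + 3 : ℕ) ψ y := fun y hy ↦
    hψ.contDiffAt (isOpen_ball.mem_nhds hy)
  have hinj : ∀ y ∈ ball (e x) r, Function.Injective (fderiv ℝ ψ y) := fun y hy ↦ by
    refine (injective_iff_map_eq_zero _).2 fun v hv ↦ ?_
    refine g.chartForm_nondegenerate hm (hsub hy) v fun w ↦ ?_
    rw [← hiso y hy, hv, map_zero, zero_apply]
  have hxr : e x ∈ ball (e x) r := mem_ball_self hr
  let T : EuclideanSpace ℝ (Fin n) ≃L[ℝ] EuclideanSpace ℝ (Fin n) :=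
    (LinearEquiv.ofInjectiveEndo (fderiv ℝ ψ (e x)).toLinearMap
      (hinj _ hxr)).toContinuousLinearEquiv
  have hT : HasFDerivAt ψ (T : EuclideanSpace ℝ (Fin n) →L[ℝ] EuclideanSpace ℝ (Fin n)) (e x) :=
    ((hψat _ hxr).differentiableAt hν).hasFDerivAt.congr_fderiv (by ext; rfl)
  set Ψ := ((hψat _ hxr).toOpenPartialHomeomorph ψ hT hν).restrOpen (ball (e x) r) isOpen_ball
  have hΨ : ∀ z, Ψ z = ψ z := fun z ↦ rfl
  have hΨs : Ψ.source ⊆ ball (e x) r := inter_subset_right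
  have hxΨ : e x ∈ Ψ.source :=
    ⟨(hψat _ hxr).mem_toOpenPartialHomeomorph_source hT hν, hxr⟩
  set φ := e.trans Ψ with hφ
  have hφs : ∀ x' ∈ φ.source, x' ∈ e.source ∧ e x' ∈ Ψ.source := fun x' hx' ↦ by
    rwa [hφ, OpenPartialHomeomorph.trans_source] at hx'
  have hev : ∀ x' ∈ φ.source, φ ∘ e.symm =ᶠ[𝓝 (e x')] ψ := fun x' hx' ↦ by
    filter_upwards [e.open_target.mem_nhds (e.map_source (hφs x' hx').1)] with z hz
    simp [hφ, e.right_inv hz, hΨ]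
  have hdiff : IsDiffeoChart ((ν + 3 : ℕ) : ℕ∞ω) φ := by
    refine isDiffeoChart_of_transition (by omega) fun x' hx' ↦
      ⟨e, he, (hφs x' hx').1, ?_, ?_⟩
    · exact (hψat _ (hΨs (hφs x' hx').2)).congr_of_eventuallyEq (hev x' hx')
    · rw [(hev x' hx').fderiv_eq]
      exact hinj _ (hΨs (hφs x' hx').2)
  refine ⟨φ, ?_, hdiff.1, hdiff.2, fun x' hx' v w ↦ ?_⟩
  · rw [hφ, OpenPartialHomeomorph.trans_source]; exact ⟨hxe, hxΨ⟩
  · obtain ⟨h1, h2⟩ := hφs x' hx'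
    have hs : e x' ∈ (e.symm.trans φ).source := by
      rw [OpenPartialHomeomorph.trans_source]
      exact ⟨e.map_source h1, by simpa [e.left_inv h1] using hx'⟩
    have h3 := hasFDerivAt_transition hm (hdiff.mdifferentiable hν) hs
    have h4 : ∀ v, fderiv ℝ ψ (e x') (chartDeriv e x' v) = chartDeriv φ x' v := fun v ↦ by
      rw [← (hev x' hx').fderiv_eq, h3.fderiv, ContinuousLinearMap.comp_apply,
        chartSymmDeriv_chartDeriv hm h1, e.left_inv h1]
    have h5 : ∀ v w : EuclideanSpace ℝ (Fin n),
        ∑ i, semiEuclideanSign p i * chartDeriv φ x' v i * chartDeriv φ x' w i = g.form x' v w :=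
      fun v w ↦ by
        rw [← semiEuclideanForm_apply, ← h4, ← h4, hiso (e x') (hΨs h2)]
        exact hform x' h1 v w
    exact h5 v w

lemma IsParallelOrthonormalFrame.of_le {m r s : ℕ∞ω} {g : SemiRiemannianMetric m p n M}
    {E : Fin n → (x : M) → TangentSpace (𝓡 n) x} {U : Set M}
    (hE : g.IsParallelOrthonormalFrame r E U) (h : s ≤ r) : g.IsParallelOrthonormalFrame s E U :=
  ⟨hE.isOpen, fun i ↦ (hE.contMDiffOn i).of_le h, hE.orthogonal, hE.unit, hE.parallel⟩

lemma curvature_eq_zero_of_isFrameFlat (h : g.IsFrameFlat 1) :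
    ∀ e ∈ smoothCharts n M, ∀ y ∈ e.target, curvature (g.chartChristoffel e) y = 0 := by
  intro e he y hy
  obtain ⟨U, hU, E, hE⟩ := h (e.symm y)
  exact hE.curvature_eq_zero he ⟨hy, hU⟩

end SemiRiemannianMetric

end Existence

end

theorem corollary3p15 {n p q k : ℕ} (hpq : p + q = n) (hk : 2 ≤ k)
    {M : Type*} [TopologicalSpace M]
    [ChartedSpace (EuclideanSpace ℝ (Fin n)) M] [IsManifold (𝓡 n) ∞ M]
    (g : SemiRiemannianMetric (k : ℕ∞ω) p n M) :
    ∃ R : TensorField13 n M,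
      -- the Riemann tensor is the tensor field `R`, which is of class `C^{k-2}`
      R.IsOfClass ((k - 2 : ℕ) : ℕ∞ω) ∧ g.RiemannEq R ∧
      -- the equivalent descriptions of flatness, in the original and in the improved regularity
      List.TFAE [
        g.IsCurvatureFlat,
        ∀ x X Y Z, R x X Y Z = 0,
        g.IsFrameFlat 1,
        g.IsFrameFlat (k : ℕ∞ω),
        g.IsCoordinateFlat 2,
        g.IsCoordinateFlat ((k + 1 : ℕ) : ℕ∞ω)] ∧
      -- every parallel orthonormal frame is `C^k`, all flat coordinates are `C^{k+1}`
      (∀ U E, g.IsParallelOrthonormalFrame 1 E U →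
        g.IsParallelOrthonormalFrame (k : ℕ∞ω) E U) ∧
      (∀ φ, g.IsFlatCoordinates 2 φ → g.IsFlatCoordinates ((k + 1 : ℕ) : ℕ∞ω) φ) := by
  obtain ⟨ν, rfl⟩ : ∃ ν, k = ν + 2 := ⟨k - 2, by omega⟩
  refine ⟨g.riemannTensor, g.isOfClass_riemannTensor, g.riemannEq_riemannTensor, ?_,
    fun U E hE ↦ hE.improve, fun φ hφ ↦ hφ.improve⟩
  tfae_have 1 ↔ 2 := g.isCurvatureFlat_iff.trans g.riemannTensor_eq_zero_iff.symm
  tfae_have 2 → 6 := fun h ↦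
    SemiRiemannianMetric.isCoordinateFlat_of_curvature_eq_zero (g.riemannTensor_eq_zero_iff.1 h)
  tfae_have 6 → 5 := fun h x ↦ (h x).imp fun φ hφ ↦
    ⟨hφ.1, hφ.2.of_le (by exact_mod_cast (by omega : 2 ≤ ν + 2 + 1))⟩
  tfae_have 5 → 4 := fun h x ↦ by
    obtain ⟨φ, hx, hφ⟩ := h x
    exact ⟨φ.source, hx, _, hφ.improve.isParallelOrthonormalFrame⟩
  tfae_have 4 → 3 := fun h x ↦ (h x).imp fun U hU ↦ ⟨hU.1, hU.2.imp fun E hE ↦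
    hE.of_le (by exact_mod_cast (by omega : 1 ≤ ν + 2))⟩
  tfae_have 3 → 2 := fun h ↦ g.riemannTensor_eq_zero_iff.2
    (SemiRiemannianMetric.curvature_eq_zero_of_isFrameFlat h)
  tfae_finish
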